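/- Let $d\ge 2$ and $n,m\ge 1$. For $y\in\{-1,1\}^d$ put $J(y)=(y(r)y(s))_{r<s}$, and for $\theta\in\mathbb R^{\bar d}$, $\bar d=d(d-1)/2$, let $C(\theta)=\sum_{y\in\{-1,1\}^d}\exp(\theta'J(y))$ and $p(y|\theta)=\exp(\theta'J(y))/C(\theta)$ (the Ising model). Fix $\theta^*,\psi\in\mathbb R^{\bar d}$ and put $h=p(\cdot|\psi)$, $T=\{(r,s):r<s,\ \theta^*_{rs}\ne0\}$, $\bar d_0=|T|$. Let $Y_1,\dots,Y_n$ be independent with density $p(\cdot|\theta^*)$. Let $Y^1,\dots,Y^m$ be a Markov chain on $\{-1,1\}^d$ with initial density $q$, generated by the random scan Gibbs sampler for $h$: in each step an index $r$ is chosen uniformly and $y(r)$ is redrawn from its conditional law under $h$ given the other coordinates. Let $\kappa$ be the largest absolute value of the eigenvalues other than $1$ of the transition matrix, and $$\beta_1=\sqrt{\sum_{y}\frac{q^2(y)}{h(y)}},\qquad \beta_2=\frac{1-\kappa}{1+\kappa},\qquad M=\max_{y}\frac{p(y|\theta^*)}{h(y)} .$$ Let $$\ell_n^m(\theta)=-\frac1n\sum_{i=1}^n\theta'J(Y_i)+\log\Big(\frac1m\sum_{k=1}^m\frac{\exp(\theta'J(Y^k))}{h(Y^k)}\Big).$$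 For $\xi>1$ let $\mathcal C(\xi,T)=\{\theta:|\theta_{T^c}|_1\le\xi|\theta_T|_1\}$ and $$F=F(\xi,T,\nabla^2\log C(\theta^*))=\inf_{0\ne\theta\in\mathcal C(\xi,T)}\frac{\theta'\,\nabla^2\log C(\theta^*)\,\theta}{|\theta_T|_1\,|\theta|_\infty}\qquad(\inf\emptyset=+\infty).$$ Let $\varepsilon>0$, $\xi>1$ and $\alpha(\xi)=2+\frac{e}{\xi-1}$. If $$n\ge\frac{8(1+\xi)^4\alpha^2(\xi)\,\bar d_0^2\,\log(2\bar d/\varepsilon)}{F^2}\qquad\text{and}\qquad m\ge\frac{64(1+\xi)^4\alpha^2(\xi)\,\bar d_0^2\,M^2\,\log[2\bar d(\bar d+1)\beta_1/\varepsilon]}{F^2\,\beta_2},$$ then with probability at least $1-4\varepsilon$ the function $\theta\mapsto\ell_n^m(\theta)+\lambda|\theta|_1$ has a minimizer, and every minimizer $\hat\theta$ of it satisfies $$|\hat\theta-\theta^*|_\infty\le\frac{2e\,\xi\,\alpha(\xi)\,\lambda}{(\xi+1)[\alpha(\xi)-2]\,F},$$ where $$\lambda=\frac{\xi+1}{\xi-1}\max\left(2\sqrt{\frac{2\log(2\bar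 d/\varepsilon)}{n}},\ 8M\sqrt{\frac{\log[(2\bar d+1)\beta_1/\varepsilon]}{m\beta_2}}\right).$$ -/

import Mathlib

open MeasureTheory ProbabilityTheory

noncomputable section

namespace IsingMCMC

/-- Spin configurations: functions from the `d` vertices to `{-1, 1}` (the units of `ℤ`). -/
abbrev Config (d : ℕ) : Type := Fin d → ℤˣ

/-- Pairs of vertices `r < s`; there are `d (d - 1) / 2` of them. -/
abbrev Pair (d : ℕ) : Type := {e : Fin d × Fin d // e.1 < e.2}

/-- Parameter vectors. The norm `‖·‖` that Mathlib puts on this function type is the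
`ℓ∞` norm, the maximum of the absolute values of the coordinates. -/
abbrev Param (d : ℕ) : Type := Pair d → ℝ

/-- The sufficient statistic `J(y) = (y(r) y(s))_{r<s}`. -/
def J {d : ℕ} (y : Config d) : Param d := fun e => ((y e.1.1 : ℤ) : ℝ) * ((y e.1.2 : ℤ) : ℝ)

/-- The norming constant `C(θ)`. -/
def normConst {d : ℕ} (θ : Param d) : ℝ := ∑ y : Config d, Real.exp (θ ⬝ᵥ J y)

/-- The density `p(y | θ)` of the Ising model. -/
def isingDensity {d : ℕ} (θ : Param d) (y : Config d) : ℝ :=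
  Real.exp (θ ⬝ᵥ J y) / normConst θ

/-- The number `d (d - 1) / 2` of parameters, as a real number. -/
def numParam (d : ℕ) : ℝ := (d : ℝ) * ((d : ℝ) - 1) / 2

/-- The set of nonzero coordinates of a parameter vector. -/
def supp {d : ℕ} (θ : Param d) : Finset (Pair d) := Finset.univ.filter fun e => θ e ≠ 0

/-- The `ℓ1` norm of the restriction of `θ` to the set `A` of coordinates. -/
def l1On {d : ℕ} (A : Finset (Pair d)) (θ : Param d) : ℝ := ∑ e ∈ A, |θ e|

/-- The Hessian matrix of second partial derivatives of `f` at `x`. -/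
def hessian {d : ℕ} (f : Param d → ℝ) (x : Param d) : Matrix (Pair d) (Pair d) ℝ :=
  fun e e' => fderiv ℝ (fun z => fderiv ℝ f z (Pi.single e' 1)) x (Pi.single e 1)

/-- The cone `{θ : |θ_{Tᶜ}|_1 ≤ ξ |θ_T|_1}`. -/
def cone {d : ℕ} (ξ : ℝ) (T : Finset (Pair d)) : Set (Param d) :=
  {θ | l1On Tᶜ θ ≤ ξ * l1On T θ}

/-- The cone invertibility factor `F(ξ, T, S)`. If `T` is empty, the cone is `{0}` and the infimum
is over the empty set; the value of `sInf` is then `0`, and since `x / 0 = 0` in `ℝ`,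
quotients by the factor have the value `0` that they have under the convention `inf ∅ = +∞`. -/
def coneInvFactor {d : ℕ} (ξ : ℝ) (T : Finset (Pair d)) (S : Matrix (Pair d) (Pair d) ℝ) : ℝ :=
  sInf {x | ∃ θ : Param d, θ ≠ 0 ∧ θ ∈ cone ξ T ∧
    x = (θ ⬝ᵥ S.mulVec θ) / (l1On T θ * ‖θ‖)}

/-- The MCMC approximation of the negative log-likelihood, for the observed sample `Y`, the Monte
Carlo sample `X` and the importance sampling density `h`. -/
def mcLogLik {d n m : ℕ} (h : Config d → ℝ) (Y : Fin n → Config d) (X : Fin m → Config d)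
    (θ : Param d) : ℝ :=
  -((1 / (n : ℝ)) * ∑ i, θ ⬝ᵥ J (Y i)) +
    Real.log ((1 / (m : ℝ)) * ∑ k, Real.exp (θ ⬝ᵥ J (X k)) / h (X k))

/-- `θ` is a (global) minimizer of the Lasso-penalized MCMC approximation. -/
def IsLassoMinimizer {d n m : ℕ} (h : Config d → ℝ) (Y : Fin n → Config d)
    (X : Fin m → Config d) (lam : ℝ) (θ : Param d) : Prop :=
  ∀ θ' : Param d, mcLogLik h Y X θ + lam * l1On Finset.univ θ ≤
    mcLogLik h Y X θ' + lam * l1On Finset.univ θ'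

/-- The probability that vertex `r` receives the spin `v` when it is updated from the
configuration `y`: the conditional law of `y(r)` given the other spins under `p(· | ψ)`. -/
def gibbsProb {d : ℕ} (ψ : Param d) (y : Config d) (r : Fin d) (v : ℤˣ) : ℝ :=
  Real.exp (ψ ⬝ᵥ J (Function.update y r v)) /
    (Real.exp (ψ ⬝ᵥ J (Function.update y r 1)) + Real.exp (ψ ⬝ᵥ J (Function.update y r (-1))))

/-- The transition matrix of the random scan Gibbs sampler with stationary density `p(· | ψ)`:
a uniformly chosen vertex gets a new spin, the other spins are kept. -/
def gibbsKernel {d : ℕ} (ψ : Param d) : Matrix (Config d) (Config d) ℝ :=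
  fun y y' => (1 / (d : ℝ)) * ∑ r : Fin d, ∑ v : ℤˣ,
    if y' = Function.update y r v then gibbsProb ψ y r v else 0

/-- `X` is a Markov chain of length `m` with initial density `q` and transition matrix `K`. -/
structure IsMarkovChain {Ω : Type*} [MeasurableSpace Ω] (P : Measure Ω) {d m : ℕ}
    (q : Config d → ℝ) (K : Matrix (Config d) (Config d) ℝ) (X : Fin m → Ω → Config d) :
    Prop where
  measurable : ∀ k, Measurable (X k)
  init : ∀ (h0 : 0 < m) (y : Config d), P.real {ω | X ⟨0, h0⟩ ω = y} = q y
  step : ∀ (k : ℕ) (hk : k + 1 < m) (x : Fin m → Config d),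
    P.real {ω | ∀ j : Fin m, j.val ≤ k + 1 → X j ω = x j} =
      P.real {ω | ∀ j : Fin m, j.val ≤ k → X j ω = x j} *
        K (x ⟨k, Nat.lt_of_succ_lt hk⟩) (x ⟨k + 1, hk⟩)

/-- `Y` is a sample of independent random vectors from the Ising model with parameter `θ`. -/
structure IsIsingSample {Ω : Type*} [MeasurableSpace Ω] (P : Measure Ω) {d n : ℕ}
    (θ : Param d) (Y : Fin n → Ω → Config d) : Prop where
  measurable : ∀ i, Measurable (Y i)
  indep : iIndepFun Y P
  law : ∀ i (y : Config d), P.real {ω | Y i ω = y} = isingDensity θ y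

/-- `κ`: the largest absolute value of a spectral value other than `1` of the transition matrix. -/
def kappa {d : ℕ} (K : Matrix (Config d) (Config d) ℝ) : ℝ :=
  sSup {a | ∃ ρ ∈ spectrum ℝ K, ρ ≠ 1 ∧ a = |ρ|}

def beta1 {d : ℕ} (q h : Config d → ℝ) : ℝ := Real.sqrt (∑ y, q y ^ 2 / h y)

def beta2 {d : ℕ} (K : Matrix (Config d) (Config d) ℝ) : ℝ := (1 - kappa K) / (1 + kappa K)

/-- `M`, the maximum over all configurations of `p(y | θ) / h(y)`. -/
def ratioMax {d : ℕ} (θ : Param d) (h : Config d → ℝ) : ℝ :=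
  ⨆ y : Config d, Real.exp (θ ⬝ᵥ J y) / (h y * normConst θ)

def alpha (ξ : ℝ) : ℝ := 2 + Real.exp 1 / (ξ - 1)

/-- The smoothing parameter `λ`, as a function of `ε`, `ξ`, `n`, `m`, `d`, `M`, `β₁`, `β₂`. -/
def lassoLam (ε ξ : ℝ) (n m d : ℕ) (M b1 b2 : ℝ) : ℝ :=
  (ξ + 1) / (ξ - 1) *
    max (2 * Real.sqrt (2 * Real.log (2 * numParam d / ε) / n))
      (8 * M * Real.sqrt (Real.log ((2 * numParam d + 1) * b1 / ε) / (m * b2)))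

end IsingMCMC

end

open IsingMCMC

noncomputable section

namespace IsingMCMC

/-! ### Hyperbolic inequalities -/

/-! The proof separates a deterministic oracle inequality, valid on a good event, from the deviation
bounds that make this event likely.

Deterministic part. On a line, `mcLogLik` is affine plus a log-sum-exp, so it is convex, and its
derivatives are importance-weighted means and covariances of the `J (X k)`. Put Δ = θ̂ - θ*, s =
|Δ|_1, x = |Δ_T|_1. If the gradient at θ* is at most λ(ξ-1)/(ξ+1) in sup norm, the penalized
objective is coercive. Optimality of θ̂ then bounds the symmetric Bregman divergence B of θ* and θ̂
by 2λ/(ξ+1)·((ξ+1)x - s); since B ≥ 0, Δ lies in the cone. Self-concordance (`bregman_ge`) gives B ≥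
(1-e^{-2s})/(2s)·V with V the weighted variance of Δ'J at θ*, and V ≥ F(α-2)/α·x|Δ|_∞ if the
weighted covariance is close to the Fisher information. `l1On_bound_arith` extracts |Δ|_∞ from these
estimates (`IsLassoMinimizer.norm_sub_le`).

Probabilistic part. The gradient and covariance errors are self-normalized importance sampling
errors, that is, sums of a mean zero function over the Gibbs chain, plus an ordinary Hoeffding term
for the observed sample. For the chain, the spectral gap dominates the quadratic form of K by that
of κI + (1-κ)1π. The tilted operator e^{g/2}Ke^{g/2} then has norm at most r as soon as
(1-κ)∑π/(re^{-g}-κ) ≤ 1. By convexity of the resolvent this need only be checked on two-point laws,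
where it is the hyperbolic inequality `exp_add_mul_exp_neg_ge`. Chernoff gives a stationary tail
bound, and Cauchy–Schwarz passes to the initial density q at the cost of the factor β₁ and half of
the exponent.

The good event fails with probability at most 3ε. When mβ₂ is too small to control the normalizing
sum of weights, λ is so large that the gradient condition holds for every realization, while the
condition on m forces T to be empty. -/

theorem mul_cosh_le_sinh_mul {y : ℝ} (hy : 0 ≤ y) :
    y * Real.cosh y ≤ Real.sinh y * (1 + y ^ 2 / 3) := by
  have h1 : ∀ x : ℝ, HasDerivAt (fun x => Real.sinh x * (1 + x ^ 2 / 3) - x * Real.cosh x)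
      (x / 3 * (x * Real.cosh x - Real.sinh x)) x := by
    intro x
    have := ((Real.hasDerivAt_sinh x).mul (((hasDerivAt_pow 2 x).div_const 3).const_add 1)).sub
      ((hasDerivAt_id x).mul (Real.hasDerivAt_cosh x))
    exact this.congr_deriv (by simp; ring)
  have h2 : ∀ x : ℝ, HasDerivAt (fun x => x * Real.cosh x - Real.sinh x)
      (x * Real.sinh x) x := by
    intro x
    have := ((hasDerivAt_id x).mul (Real.hasDerivAt_cosh x)).sub (Real.hasDerivAt_sinh x)
    exact this.congr_deriv (by simp)
  have m2 : MonotoneOn (fun x => x * Real.cosh x - Real.sinh x) (Set.Ici 0) := by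
    refine monotoneOn_of_deriv_nonneg (convex_Ici 0)
      (fun x _ => (h2 x).continuousAt.continuousWithinAt)
      (fun x _ => (h2 x).differentiableAt.differentiableWithinAt) fun x hx => ?_
    rw [(h2 x).deriv]
    rw [interior_Ici] at hx
    exact mul_nonneg (le_of_lt hx) (Real.sinh_nonneg_iff.2 (le_of_lt hx))
  have m1 : MonotoneOn (fun x => Real.sinh x * (1 + x ^ 2 / 3) - x * Real.cosh x) (Set.Ici 0) := by
    refine monotoneOn_of_deriv_nonneg (convex_Ici 0)
      (fun x _ => (h1 x).continuousAt.continuousWithinAt)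
      (fun x _ => (h1 x).differentiableAt.differentiableWithinAt) fun x hx => ?_
    rw [(h1 x).deriv]
    rw [interior_Ici] at hx
    have hx' : 0 ≤ x := le_of_lt hx
    have := m2 (Set.mem_Ici.2 le_rfl) (Set.mem_Ici.2 hx') hx'
    simp at this
    exact mul_nonneg (by positivity) (by linarith)
  have := m1 (Set.mem_Ici.2 le_rfl) (Set.mem_Ici.2 hy) hy
  simp at this
  linarith

theorem six_pow_mul_factorial_le (k : ℕ) : 6 ^ k * k.factorial ≤ (2 * k + 1).factorial := by
  induction k with
  | zero => simp
  | succ k ih =>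
    have h : (2 * (k + 1) + 1).factorial = (2 * k + 3) * ((2 * k + 2) * (2 * k + 1).factorial) := by
      rw [show 2 * (k + 1) + 1 = (2 * k + 1) + 1 + 1 by ring, Nat.factorial_succ, Nat.factorial_succ]
    rw [h, pow_succ, Nat.factorial_succ]
    calc 6 ^ k * 6 * ((k + 1) * k.factorial) = (6 * (k + 1)) * (6 ^ k * k.factorial) := by ring
      _ ≤ (6 * (k + 1)) * (2 * k + 1).factorial := by gcongr
      _ ≤ ((2 * k + 3) * (2 * k + 2)) * (2 * k + 1).factorial := by
        exact Nat.mul_le_mul_right _ (by nlinarith)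
      _ = _ := by ring

/-- Termwise comparison of the two power series, by `six_pow_mul_factorial_le`. -/
theorem sinh_le_mul_exp {y : ℝ} (hy : 0 ≤ y) : Real.sinh y ≤ y * Real.exp (y ^ 2 / 6) := by
  have h := (NormedSpace.expSeries_div_hasSum_exp (𝔸 := ℝ) (y ^ 2 / 6)).mul_left y
  rw [← Real.exp_eq_exp_ℝ] at h
  refine hasSum_le (fun k => ?_) (Real.hasSum_sinh y) h
  have h6 : (6 : ℝ) ^ k * k.factorial ≤ (2 * k + 1).factorial := by
    exact_mod_cast six_pow_mul_factorial_le k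
  rw [div_pow, div_div, ← pow_mul, mul_div_assoc', ← pow_succ']
  gcongr

/-- The inequality behind the Hoeffding bound for two-state chains with spectral gap `1 - κ`. -/
theorem exp_add_mul_exp_neg_ge {κ y q z : ℝ} (hκ0 : 0 ≤ κ) (hκ1 : κ < 1) (hy : 0 < y)
    (hz : z = (1 + κ) / (1 - κ) * (y ^ 2 / 2) - q * y) :
    (1 + κ) * Real.cosh y - (1 - κ) * q * Real.sinh y ≤ Real.exp z + κ * Real.exp (-z) := by
  -- The function e^w - vw is minimal at w = log v, with value v(1 - log v) ≥ v(1 - y²/6). Using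
  -- this at z and, with weight κ, at -z makes the bound on cosh fit exactly, because 1/3 - 1/2 =
  -- -1/6.
  set v := Real.sinh y / y with hv
  have hs : Real.sinh y = v * y := by rw [hv]; field_simp
  have hv0 : 0 < v := div_pos (Real.sinh_pos_iff.2 hy) hy
  have hlog : Real.log v ≤ y ^ 2 / 6 := by
    rw [Real.log_le_iff_le_exp hv0, hv, div_le_iff₀ hy, mul_comm]
    exact sinh_le_mul_exp hy.le
  have key : ∀ w : ℝ, v * (1 - y ^ 2 / 6) ≤ Real.exp w - v * w := by
    intro w
    have h1 := Real.add_one_le_exp (w - Real.log v)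
    rw [Real.exp_sub, Real.exp_log hv0, le_div_iff₀ hv0] at h1
    nlinarith
  have h1 := key z
  have h2 := mul_le_mul_of_nonneg_left (key (-z)) hκ0
  have h3 := mul_cosh_le_sinh_mul hy.le
  rw [hs] at h3
  have h4 : Real.cosh y ≤ v * (1 + y ^ 2 / 3) := by
    refine le_of_mul_le_mul_left ?_ hy
    linarith
  have h5 : (1 - κ) * (q * y) = (1 + κ) * (y ^ 2 / 2) - (1 - κ) * z := by
    have : (1 - κ) ≠ 0 := by linarith
    rw [hz]; field_simp; ring
  have h6 : (1 - κ) * q * Real.sinh y = v * ((1 + κ) * (y ^ 2 / 2) - (1 - κ) * z) := by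
    rw [← h5, hs]; ring
  have h7 := mul_le_mul_of_nonneg_left h4 (by linarith : 0 ≤ 1 + κ)
  rw [h6]
  linarith

/-- The two-point case of the resolvent bound. -/
theorem two_point_resolvent {κ x p r : ℝ} (hκ0 : 0 ≤ κ) (hκ1 : κ < 1) (hx : 0 < x) (hp : 0 < p)
    (hr : r = Real.exp ((1 + κ) / (1 - κ) * (x ^ 2 / 8))) :
    κ < r * Real.exp (-((1 - p) * x)) ∧ κ < r * Real.exp (p * x) ∧
      (1 - κ) * (p / (r * Real.exp (-((1 - p) * x)) - κ) + (1 - p) / (r * Real.exp (p * x) - κ))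
        ≤ 1 := by
  set A := r * Real.exp (-((1 - p) * x)) with hA
  set B := r * Real.exp (p * x) with hB
  set z := (1 + κ) / (1 - κ) * ((x / 2) ^ 2 / 2) - (1 - 2 * p) * (x / 2) with hz
  -- With y = x/2 and q = 1 - 2p, e^z is the geometric mean of A and B; multiplied by e^z, the
  -- inequality becomes the claim with denominators cleared.
  have main := exp_add_mul_exp_neg_ge (q := 1 - 2 * p) hκ0 hκ1 (half_pos hx) hz
  have hAz : A = Real.exp z * Real.exp (-(x / 2)) := by
    rw [hA, hr, ← Real.exp_add, ← Real.exp_add, hz]; congr 1; ring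
  have hBz : B = Real.exp z * Real.exp (x / 2) := by
    rw [hB, hr, ← Real.exp_add, ← Real.exp_add, hz]; congr 1; ring
  have e1 : Real.exp (x / 2) * Real.exp (-(x / 2)) = 1 := by rw [← Real.exp_add]; simp
  have e2 : Real.exp z * Real.exp (-z) = 1 := by rw [← Real.exp_add]; simp
  have hprod : (1 - κ) * (p * (B - κ) + (1 - p) * (A - κ)) ≤ (A - κ) * (B - κ) := by
    rw [Real.cosh_eq, Real.sinh_eq] at main
    have := mul_le_mul_of_nonneg_left main (Real.exp_pos z).le
    rw [hAz, hBz]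
    generalize Real.exp z = E at *
    generalize Real.exp (-z) = E' at *
    generalize Real.exp (x / 2) = F at *
    generalize Real.exp (-(x / 2)) = F' at *
    have h1 : E * (E' * κ) = κ := by rw [← mul_assoc, e2]; ring
    have h2 : E * F' * (E * F) = E * E := by
      calc E * F' * (E * F) = E * E * (F * F') := by ring
        _ = _ := by rw [e1]; ring
    have h3 : (E * F' - κ) * (E * F - κ) = E * E - κ * (E * F' + E * F) + κ ^ 2 := by
      rw [← h2]; ring
    rw [h3]
    linarith
  have hr1 : 1 ≤ r := by
    rw [hr]; apply Real.one_le_exp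
    have : 0 < 1 - κ := by linarith
    positivity
  have hB1 : 1 ≤ B := by
    rw [hB]
    exact one_le_mul_of_one_le_of_one_le hr1 (Real.one_le_exp (by positivity))
  have hBκ : 0 < B - κ := by linarith
  -- A itself may be below 1, so positivity of A - κ is read off the cleared inequality: its
  -- cofactor there and the remaining term are both positive.
  have hAκ : 0 < A - κ := by
    have hb : 0 < (B - κ) - (1 - κ) * (1 - p) := by nlinarith
    have : 0 < (A - κ) * ((B - κ) - (1 - κ) * (1 - p)) := by
      have : 0 < (1 - κ) * p * (B - κ) := mul_pos (mul_pos (by linarith) hp) hBκ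
      linarith
    exact pos_of_mul_pos_left this hb.le
  refine ⟨by linarith, by linarith, ?_⟩
  rw [div_add_div _ _ hAκ.ne' hBκ.ne', ← mul_div_assoc, div_le_one (mul_pos hAκ hBκ)]
  linarith

/-- With w = re^{-x}, the second derivative is w(w+κ)/(w-κ)³. Convexity is what reduces general laws
to two-point laws. -/
theorem convexOn_resolvent {κ r : ℝ} (hκ0 : 0 ≤ κ) (hr : 0 < r) :
    ConvexOn ℝ {x : ℝ | κ < r * Real.exp (-x)} fun x => (r * Real.exp (-x) - κ)⁻¹ := by
  have hopen : IsOpen {x : ℝ | κ < r * Real.exp (-x)} :=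
    isOpen_lt continuous_const (by fun_prop)
  have hconv : Convex ℝ {x : ℝ | κ < r * Real.exp (-x)} := by
    refine Set.OrdConnected.convex ⟨fun a _ b hb x hx => ?_⟩
    refine lt_of_lt_of_le (show κ < r * Real.exp (-b) from hb) ?_
    have := hx.2
    gcongr
  have hd : ∀ x : ℝ, HasDerivAt (fun x => r * Real.exp (-x) - κ) (-(r * Real.exp (-x))) x := by
    intro x
    have := (((hasDerivAt_neg x).exp).const_mul r).sub_const κ
    exact this.congr_deriv (by ring)
  have hd1 : ∀ x ∈ {x : ℝ | κ < r * Real.exp (-x)},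
      HasDerivAt (fun x => (r * Real.exp (-x) - κ)⁻¹)
        (r * Real.exp (-x) / (r * Real.exp (-x) - κ) ^ 2) x := by
    intro x hx
    have hx' : κ < r * Real.exp (-x) := hx
    have := (hd x).inv (by linarith)
    exact this.congr_deriv (by simp)
  have hd2 : ∀ x ∈ {x : ℝ | κ < r * Real.exp (-x)},
      HasDerivAt (fun x => r * Real.exp (-x) / (r * Real.exp (-x) - κ) ^ 2)
        ((r * Real.exp (-x)) * (r * Real.exp (-x) + κ) / (r * Real.exp (-x) - κ) ^ 3) x := by
    intro x hx
    have hx' : 0 < r * Real.exp (-x) - κ := by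
      have : κ < r * Real.exp (-x) := hx
      linarith
    have h0 : HasDerivAt (fun x => r * Real.exp (-x)) (-(r * Real.exp (-x))) x := by
      simpa using (hd x).add_const κ
    have := h0.div ((hd x).pow 2) (pow_pos hx' 2).ne'
    refine this.congr_deriv ?_
    simp only [Pi.pow_apply]
    field_simp
    ring
  refine convexOn_of_deriv2_nonneg' hconv
    (fun x hx => (hd1 x hx).differentiableAt.differentiableWithinAt) ?_ ?_
  · intro x hx
    have he : deriv (fun x => (r * Real.exp (-x) - κ)⁻¹) =ᶠ[nhds x]
        fun x => r * Real.exp (-x) / (r * Real.exp (-x) - κ) ^ 2 := by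
      filter_upwards [hopen.mem_nhds hx] with y hy using (hd1 y hy).deriv
    exact (he.differentiableAt_iff.2 (hd2 x hx).differentiableAt).differentiableWithinAt
  · intro x hx
    have he : deriv (fun x => (r * Real.exp (-x) - κ)⁻¹) =ᶠ[nhds x]
        fun x => r * Real.exp (-x) / (r * Real.exp (-x) - κ) ^ 2 := by
      filter_upwards [hopen.mem_nhds hx] with y hy using (hd1 y hy).deriv
    have hx' : 0 < r * Real.exp (-x) - κ := by
      have : κ < r * Real.exp (-x) := hx
      linarith
    rw [Function.iterate_succ, Function.iterate_one, Function.comp_apply, he.deriv_eq,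
      (hd2 x hx).deriv]
    positivity

/-- For a mean zero function `g` with values in `[-p x, (1 - p) x]`, the rank one perturbation
bound of the tilted operator holds with the Hoeffding constant. -/
theorem sum_resolvent_le_one {S : Type*} [Fintype S] {π g : S → ℝ} (hπ : ∀ s, 0 ≤ π s)
    (hπ1 : ∑ s, π s = 1) (hg0 : ∑ s, π s * g s = 0) {κ x p r : ℝ} (hκ0 : 0 ≤ κ) (hκ1 : κ < 1)
    (hx : 0 < x) (hp : 0 < p)
    (hr : r = Real.exp ((1 + κ) / (1 - κ) * (x ^ 2 / 8)))
    (hgl : ∀ s, -(p * x) ≤ g s) (hgu : ∀ s, g s ≤ (1 - p) * x) :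
    (∀ s, κ < r * Real.exp (-g s)) ∧ (1 - κ) * ∑ s, π s * (r * Real.exp (-g s) - κ)⁻¹ ≤ 1 := by
  obtain ⟨hA, hB, hAB⟩ := two_point_resolvent hκ0 hκ1 hx hp hr
  have hr0 : 0 < r := by rw [hr]; exact Real.exp_pos _
  refine ⟨fun s => lt_of_lt_of_le hA ?_, ?_⟩
  · have := hgu s
    gcongr
  have hc := convexOn_resolvent hκ0 hr0
  set f : ℝ → ℝ := fun x => (r * Real.exp (-x) - κ)⁻¹ with hf
  have hB' : κ < r * Real.exp (-(-(p * x))) := by simpa using hB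
  -- The chord over the interval is affine in g, so averaging under π with mean zero leaves exactly
  -- the two-point law with weights 1 - p and p.
  have chord : ∀ s, f (g s) ≤ (1 - p - g s / x) * f (-(p * x)) + (p + g s / x) * f ((1 - p) * x) := by
    intro s
    have h1 := hgl s
    have h2 := hgu s
    have ha : 0 ≤ 1 - p - g s / x := by
      have : g s / x ≤ 1 - p := by rwa [div_le_iff₀ hx]
      linarith
    have hb : 0 ≤ p + g s / x := by
      have : -p ≤ g s / x := by rw [le_div_iff₀ hx]; linarith
      linarith
    have := hc.2 (x := -(p * x)) hB' (y := (1 - p) * x) hA ha hb (by ring)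
    simp only [smul_eq_mul] at this
    have he : (1 - p - g s / x) * -(p * x) + (p + g s / x) * ((1 - p) * x) = g s := by
      field_simp
      ring
    rwa [he] at this
  have h1 : ∑ s, π s * f (g s) ≤ (1 - p) * f (-(p * x)) + p * f ((1 - p) * x) := by
    calc ∑ s, π s * f (g s)
        ≤ ∑ s, π s * ((1 - p - g s / x) * f (-(p * x)) + (p + g s / x) * f ((1 - p) * x)) :=
          Finset.sum_le_sum fun s _ => mul_le_mul_of_nonneg_left (chord s) (hπ s)
      _ = ∑ s, (π s * ((1 - p) * f (-(p * x)) + p * f ((1 - p) * x)) +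
            (π s * g s) * ((f ((1 - p) * x) - f (-(p * x))) / x)) := by
          refine Finset.sum_congr rfl fun s _ => ?_
          field_simp
          ring
      _ = _ := by
          rw [Finset.sum_add_distrib, ← Finset.sum_mul, ← Finset.sum_mul, hπ1, hg0]
          ring
  have h2 : (1 - p) * f (-(p * x)) + p * f ((1 - p) * x) =
      p / (r * Real.exp (-((1 - p) * x)) - κ) + (1 - p) / (r * Real.exp (p * x) - κ) := by
    simp only [hf, neg_neg]
    ring
  calc (1 - κ) * ∑ s, π s * f (g s)
      ≤ (1 - κ) * ((1 - p) * f (-(p * x)) + p * f ((1 - p) * x)) :=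
        mul_le_mul_of_nonneg_left h1 (by linarith)
    _ ≤ 1 := by rw [h2]; exact hAB

/-! ### Exponential moments of reversible Markov chains -/

section Chain

variable {S : Type*} [Fintype S]

/-- The weight of a path under the initial density `μ` and the transition matrix `K`. -/
def pathWeight (μ : S → ℝ) (K : Matrix S S ℝ) {k : ℕ} (x : Fin (k + 1) → S) : ℝ :=
  μ (x 0) * ∏ i : Fin k, K (x i.castSucc) (x i.succ)

/-- `K` is a stochastic matrix, reversible with respect to the positive density `π`, whose
quadratic form is dominated by that of `κ I + (1 - κ) 1 π`. -/
structure IsReversibleGap (π : S → ℝ) (K : Matrix S S ℝ) (κ : ℝ) : Prop where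
  pos : ∀ s, 0 < π s
  sum_eq_one : ∑ s, π s = 1
  nonneg : ∀ s t, 0 ≤ K s t
  row_sum : ∀ s, ∑ t, K s t = 1
  reversible : ∀ s t, π s * K s t = π t * K t s
  gap_nonneg : 0 ≤ κ
  gap_lt_one : κ < 1
  form_le : ∀ u : S → ℝ, |∑ s, π s * (u s * (K.mulVec u) s)| ≤
    κ * ∑ s, π s * u s ^ 2 + (1 - κ) * (∑ s, π s * u s) ^ 2

/-- Summing out the first state absorbs it into a new initial density; this drives the inductions on
the path length. -/
theorem sum_pathWeight_cons (μ : S → ℝ) (K : Matrix S S ℝ) (φ : S → ℝ) {k : ℕ} :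
    ∑ x : Fin (k + 2) → S, pathWeight μ K x * ∏ i, φ (x i) =
      ∑ x : Fin (k + 1) → S,
        pathWeight (fun t => ∑ s, μ s * φ s * K s t) K x * ∏ i, φ (x i) := by
  rw [← (Fin.consEquiv fun _ : Fin (k + 2) => S).sum_comp, Fintype.sum_prod_type_right]
  refine Finset.sum_congr rfl fun x _ => ?_
  simp only [pathWeight, Fin.consEquiv_apply, Finset.sum_mul]
  refine Finset.sum_congr rfl fun s _ => ?_
  rw [Fin.prod_univ_succ, Fin.prod_univ_succ (n := k + 1)]
  simp only [Fin.cons_zero, Fin.castSucc_zero, Fin.cons_succ, ← Fin.succ_castSucc]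
  ring

variable {π : S → ℝ} {K : Matrix S S ℝ} {κ : ℝ}

namespace IsReversibleGap

theorem bilin_symm (h : IsReversibleGap π K κ) (u v : S → ℝ) :
    ∑ s, π s * (u s * (K.mulVec v) s) = ∑ s, π s * (v s * (K.mulVec u) s) := by
  simp only [Matrix.mulVec, dotProduct, Finset.mul_sum]
  rw [Finset.sum_comm]
  refine Finset.sum_congr rfl fun t _ => Finset.sum_congr rfl fun s _ => ?_
  linear_combination (u s * v t) * h.reversible s t

/-- Reversibility keeps the transported density of the form π times a function, namely K applied to
the old function. -/
theorem stationary (h : IsReversibleGap π K κ) (φ : S → ℝ) (t : S) :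
    ∑ s, π s * φ s * K s t = π t * (K.mulVec φ) t := by
  simp only [Matrix.mulVec, dotProduct, Finset.mul_sum]
  refine Finset.sum_congr rfl fun s _ => ?_
  linear_combination φ s * h.reversible s t

/-- Domination of the tilted quadratic form. -/
theorem rank_one_form_le (h : IsReversibleGap π K κ) {g : S → ℝ} {r : ℝ}
    (hr : ∀ s, κ < r * Real.exp (-g s))
    (hsum : (1 - κ) * ∑ s, π s * (r * Real.exp (-g s) - κ)⁻¹ ≤ 1) (u : S → ℝ) :
    κ * ∑ s, π s * u s ^ 2 + (1 - κ) * (∑ s, π s * u s) ^ 2 ≤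
      r * ∑ s, π s * (Real.exp (-g s) * u s ^ 2) := by
  have hτ : ∀ s, 0 < r * Real.exp (-g s) - κ := fun s => by linarith [hr s]
  -- Cauchy–Schwarz with the weight re^{-g} - κ, which is what remains of the diagonal form once κI
  -- is subtracted.
  have cs : (∑ s, π s * u s) ^ 2 ≤ (∑ s, π s * (r * Real.exp (-g s) - κ)⁻¹) *
      ∑ s, π s * ((r * Real.exp (-g s) - κ) * u s ^ 2) := by
    refine Finset.sum_sq_le_sum_mul_sum_of_sq_le_mul _ (fun s _ => ?_) (fun s _ => ?_)
      (fun s _ => ?_)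
    · exact mul_nonneg (h.pos s).le (inv_nonneg.2 (hτ s).le)
    · exact mul_nonneg (h.pos s).le (mul_nonneg (hτ s).le (sq_nonneg _))
    · have := (hτ s).ne'
      refine le_of_eq ?_
      field_simp
  have hQ : 0 ≤ ∑ s, π s * ((r * Real.exp (-g s) - κ) * u s ^ 2) :=
    Finset.sum_nonneg fun s _ => mul_nonneg (h.pos s).le (mul_nonneg (hτ s).le (sq_nonneg _))
  have e : ∑ s, π s * ((r * Real.exp (-g s) - κ) * u s ^ 2) =
      r * ∑ s, π s * (Real.exp (-g s) * u s ^ 2) - κ * ∑ s, π s * u s ^ 2 := by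
    rw [Finset.mul_sum, Finset.mul_sum, ← Finset.sum_sub_distrib]
    refine Finset.sum_congr rfl fun s _ => ?_
    ring
  have h1 : (1 - κ) * (∑ s, π s * u s) ^ 2 ≤
      1 * ∑ s, π s * ((r * Real.exp (-g s) - κ) * u s ^ 2) := by
    calc _ ≤ (1 - κ) * ((∑ s, π s * (r * Real.exp (-g s) - κ)⁻¹) *
          ∑ s, π s * ((r * Real.exp (-g s) - κ) * u s ^ 2)) :=
          mul_le_mul_of_nonneg_left cs (by linarith [h.gap_lt_one])
      _ = ((1 - κ) * ∑ s, π s * (r * Real.exp (-g s) - κ)⁻¹) *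
          ∑ s, π s * ((r * Real.exp (-g s) - κ) * u s ^ 2) := by ring
      _ ≤ _ := mul_le_mul_of_nonneg_right hsum hQ
  linarith

/-- The tilted transition operator is a contraction up to the factor `r`. -/
theorem tilted_contraction (h : IsReversibleGap π K κ) {g : S → ℝ} {r : ℝ} (hr0 : 0 < r)
    (hform : ∀ u : S → ℝ, κ * ∑ s, π s * u s ^ 2 + (1 - κ) * (∑ s, π s * u s) ^ 2 ≤
      r * ∑ s, π s * (Real.exp (-g s) * u s ^ 2)) (φ : S → ℝ) :
    ∑ s, π s * (Real.exp (g s) * (K.mulVec fun t => Real.exp (g t) * φ t) s ^ 2) ≤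
      r ^ 2 * ∑ s, π s * (Real.exp (g s) * φ s ^ 2) := by
  have hB : ∀ u : S → ℝ, |∑ s, π s * (u s * (K.mulVec u) s)| ≤
      r * ∑ s, π s * (Real.exp (-g s) * u s ^ 2) := fun u => (h.form_le u).trans (hform u)
  have hee : ∀ s, Real.exp (-g s) * Real.exp (g s) = 1 := fun s => by
    rw [← Real.exp_add]; simp
  set v : S → ℝ := fun t => Real.exp (g t) * φ t with hv
  set w : S → ℝ := K.mulVec v with hw
  -- Polarization: the bounds on the form at u + v and u - v control the bilinear form of K at (u,
  -- v). With this u it equals N/r, and half of the resulting right side is absorbed on the left.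
  -- Both signs of the form are needed, hence the absolute value in `form_le`.
  set u : S → ℝ := fun t => r⁻¹ * (Real.exp (g t) * w t) with hu
  set N := ∑ s, π s * (Real.exp (g s) * w s ^ 2) with hN
  set N0 := ∑ s, π s * (Real.exp (g s) * φ s ^ 2) with hN0
  have hQv : ∑ s, π s * (Real.exp (-g s) * v s ^ 2) = N0 := by
    refine Finset.sum_congr rfl fun s _ => ?_
    simp only [hv]
    linear_combination (π s * Real.exp (g s) * φ s ^ 2) * hee s
  have hQu : ∑ s, π s * (Real.exp (-g s) * u s ^ 2) = r⁻¹ ^ 2 * N := by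
    rw [hN, Finset.mul_sum]
    refine Finset.sum_congr rfl fun s _ => ?_
    simp only [hu]
    linear_combination (r⁻¹ ^ 2 * π s * Real.exp (g s) * w s ^ 2) * hee s
  have huv : ∑ s, π s * (u s * (K.mulVec v) s) = r⁻¹ * N := by
    rw [hN, Finset.mul_sum]
    refine Finset.sum_congr rfl fun s _ => ?_
    simp only [hu, ← hw]
    ring
  have hp := le_of_abs_le (hB (u + v))
  have hm := neg_le_of_abs_le (hB (u - v))
  simp only [Matrix.mulVec_add, Matrix.mulVec_sub, Pi.add_apply, Pi.sub_apply] at hp hm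
  have hsymm := h.bilin_symm v u
  have e1 : ∑ s, π s * ((u s + v s) * ((K.mulVec u) s + (K.mulVec v) s)) =
      ∑ s, π s * (u s * (K.mulVec u) s) + ∑ s, π s * (u s * (K.mulVec v) s) +
      ∑ s, π s * (v s * (K.mulVec u) s) + ∑ s, π s * (v s * (K.mulVec v) s) := by
    simp only [← Finset.sum_add_distrib]
    refine Finset.sum_congr rfl fun s _ => ?_
    ring
  have e2 : ∑ s, π s * ((u s - v s) * ((K.mulVec u) s - (K.mulVec v) s)) =
      ∑ s, π s * (u s * (K.mulVec u) s) - ∑ s, π s * (u s * (K.mulVec v) s) -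
      ∑ s, π s * (v s * (K.mulVec u) s) + ∑ s, π s * (v s * (K.mulVec v) s) := by
    simp only [← Finset.sum_add_distrib, ← Finset.sum_sub_distrib]
    refine Finset.sum_congr rfl fun s _ => ?_
    ring
  have e3 : ∑ s, π s * (Real.exp (-g s) * (u s + v s) ^ 2) +
      ∑ s, π s * (Real.exp (-g s) * (u s - v s) ^ 2) =
      2 * (∑ s, π s * (Real.exp (-g s) * u s ^ 2) + ∑ s, π s * (Real.exp (-g s) * v s ^ 2)) := by
    simp only [← Finset.sum_add_distrib, Finset.mul_sum]
    refine Finset.sum_congr rfl fun s _ => ?_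
    ring
  rw [hQv, hQu] at e3
  have h4 : 4 * (r⁻¹ * N) ≤ r * (2 * (r⁻¹ ^ 2 * N + N0)) := by
    rw [← e3]
    rw [e1] at hp
    rw [e2] at hm
    linarith
  have h5 : r * (2 * (r⁻¹ ^ 2 * N + N0)) = 2 * (r⁻¹ * N) + 2 * r * N0 := by
    field_simp
  have h6 : r⁻¹ * N ≤ r * N0 := by linarith
  have h7 := mul_le_mul_of_nonneg_left h6 hr0.le
  rw [mul_inv_cancel_left₀ hr0.ne'] at h7
  linarith

/-- Each transition costs one factor r in the norm weighted by πe^g; the last state is closed by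
Cauchy–Schwarz. -/
theorem sum_pathWeight_mul_prod_le (h : IsReversibleGap π K κ) {g : S → ℝ} {r : ℝ} (hr0 : 0 < r)
    (hform : ∀ u : S → ℝ, κ * ∑ s, π s * u s ^ 2 + (1 - κ) * (∑ s, π s * u s) ^ 2 ≤
      r * ∑ s, π s * (Real.exp (-g s) * u s ^ 2)) {k : ℕ} (φ : S → ℝ) :
    ∑ x : Fin (k + 1) → S, pathWeight (fun s => π s * φ s) K x * ∏ i, Real.exp (g (x i)) ≤
      r ^ k * (√(∑ s, π s * Real.exp (g s)) * √(∑ s, π s * (Real.exp (g s) * φ s ^ 2))) := by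
  induction k generalizing φ with
  | zero =>
    rw [← (Equiv.funUnique (Fin 1) S).symm.sum_comp]
    simp only [pathWeight, pow_zero, one_mul, Finset.prod_const, Finset.card_univ, Fintype.card_fin, zero_add, pow_one, Equiv.funUnique_symm_apply, uniqueElim_const]
    rw [← Real.sqrt_mul (Finset.sum_nonneg fun s _ => mul_nonneg (h.pos s).le (Real.exp_pos _).le)]
    refine Real.le_sqrt_of_sq_le ?_
    refine Finset.sum_sq_le_sum_mul_sum_of_sq_le_mul _ (fun s _ => ?_) (fun s _ => ?_)
      (fun s _ => ?_)
    · exact mul_nonneg (h.pos s).le (Real.exp_pos _).le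
    · exact mul_nonneg (h.pos s).le (mul_nonneg (Real.exp_pos _).le (sq_nonneg _))
    · exact le_of_eq (by simp; ring)
  | succ k ih =>
    rw [sum_pathWeight_cons (fun s => π s * φ s) K fun s => Real.exp (g s)]
    have e : (fun t => ∑ s, π s * φ s * Real.exp (g s) * K s t) =
        fun t => π t * (K.mulVec fun s => Real.exp (g s) * φ s) t := by
      funext t
      rw [← h.stationary]
      refine Finset.sum_congr rfl fun s _ => ?_
      ring
    rw [e]
    refine (ih _).trans ?_
    have hc := Real.sqrt_le_sqrt (h.tilted_contraction hr0 hform φ)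
    rw [Real.sqrt_mul (sq_nonneg r), Real.sqrt_sq hr0.le] at hc
    calc _ ≤ r ^ k * (√(∑ s, π s * Real.exp (g s)) *
          (r * √(∑ s, π s * (Real.exp (g s) * φ s ^ 2)))) := by gcongr
      _ = _ := by ring

/-- The Leon-Perron bound on exponential moments of a stationary reversible chain. -/
theorem exp_moment_le (h : IsReversibleGap π K κ) {g : S → ℝ} {a b : ℝ} (ha : a < 0) (hb : 0 < b)
    (hg : ∀ s, g s ∈ Set.Icc a b) (hg0 : ∑ s, π s * g s = 0) (k : ℕ) :
    ∑ x : Fin (k + 1) → S, pathWeight π K x * ∏ i, Real.exp (g (x i)) ≤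
      Real.exp ((k + 1) * ((1 + κ) / (1 - κ) * ((b - a) ^ 2 / 8))) := by
  have hx : 0 < b - a := by linarith
  set r := Real.exp ((1 + κ) / (1 - κ) * ((b - a) ^ 2 / 8)) with hr
  have hr0 : 0 < r := Real.exp_pos _
  have hp : 0 < -a / (b - a) := div_pos (by linarith) hx
  have hpx : -a / (b - a) * (b - a) = -a := by field_simp
  obtain ⟨h1, h2⟩ := sum_resolvent_le_one (fun s => (h.pos s).le) h.sum_eq_one hg0 h.gap_nonneg
    h.gap_lt_one hx hp hr (fun s => by rw [hpx]; linarith [(hg s).1])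
    (fun s => by rw [sub_mul, hpx]; linarith [(hg s).2])
  have hform := h.rank_one_form_le h1 h2
  -- There are k transitions but k + 1 states. The missing factor r comes from the dominated form at
  -- u = e^g: with E² ≤ ∑ πe^{2g} it yields E² ≤ rE.
  have hE : ∑ s, π s * Real.exp (g s) ≤ r := by
    have hf := hform fun s => Real.exp (g s)
    set E := ∑ s, π s * Real.exp (g s) with hE
    have hE0 : 0 < E := by
      have hne : (Finset.univ : Finset S).Nonempty := by
        by_contra hne
        have := h.sum_eq_one
        rw [Finset.not_nonempty_iff_eq_empty.1 hne] at this
        simp at this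
      exact Finset.sum_pos (fun s _ => mul_pos (h.pos s) (Real.exp_pos _)) hne
    have cs : E ^ 2 ≤ (∑ s, π s) * ∑ s, π s * Real.exp (g s) ^ 2 :=
      Finset.sum_sq_le_sum_mul_sum_of_sq_le_mul _ (fun s _ => (h.pos s).le)
        (fun s _ => mul_nonneg (h.pos s).le (sq_nonneg _)) (fun s _ => le_of_eq (by ring))
    rw [h.sum_eq_one, one_mul] at cs
    have e : ∑ s, π s * (Real.exp (-g s) * Real.exp (g s) ^ 2) = E := by
      refine Finset.sum_congr rfl fun s _ => ?_
      rw [pow_two, ← mul_assoc (Real.exp (-g s)), ← Real.exp_add]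
      simp
    rw [e] at hf
    have := mul_le_mul_of_nonneg_left cs h.gap_nonneg
    nlinarith
  have := h.sum_pathWeight_mul_prod_le hr0 hform (k := k) fun _ => 1
  simp only [mul_one, one_pow] at this
  refine this.trans ?_
  rw [Real.mul_self_sqrt (Finset.sum_nonneg fun s _ => mul_nonneg (h.pos s).le (Real.exp_pos _).le)]
  calc r ^ k * ∑ s, π s * Real.exp (g s) ≤ r ^ k * r := by gcongr
    _ = _ := by rw [← pow_succ, hr, ← Real.exp_nat_mul]; push_cast; ring_nf

theorem pathWeight_nonneg (h : IsReversibleGap π K κ) {μ : S → ℝ} (hμ : ∀ s, 0 ≤ μ s) {k : ℕ}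
    (x : Fin (k + 1) → S) : 0 ≤ pathWeight μ K x :=
  mul_nonneg (hμ _) (Finset.prod_nonneg fun _ _ => h.nonneg _ _)

theorem sum_pathWeight (h : IsReversibleGap π K κ) (μ : S → ℝ) (k : ℕ) :
    ∑ x : Fin (k + 1) → S, pathWeight μ K x = ∑ s, μ s := by
  induction k generalizing μ with
  | zero =>
    rw [← (Equiv.funUnique (Fin 1) S).symm.sum_comp]
    simp [pathWeight]
  | succ k ih =>
    have := sum_pathWeight_cons μ K (fun _ => 1) (k := k)
    simp only [Finset.prod_const_one, mul_one] at this
    rw [this, ih, Finset.sum_comm]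
    simp only [← Finset.mul_sum, h.row_sum, mul_one]

/-- Hoeffding bound for a stationary reversible chain. -/
theorem stationary_tail_le (h : IsReversibleGap π K κ) {f : S → ℝ} {a b t : ℝ} (ha : a < 0)
    (hb : 0 < b) (hf : ∀ s, f s ∈ Set.Icc a b) (hf0 : ∑ s, π s * f s = 0) (ht : 0 < t) (k : ℕ)
    (A : Finset (Fin (k + 1) → S)) (hA : ∀ x ∈ A, (k + 1) * t ≤ ∑ i, f (x i)) :
    ∑ x ∈ A, pathWeight π K x ≤
      Real.exp (-(2 * (k + 1) * ((1 - κ) / (1 + κ)) * t ^ 2 / (b - a) ^ 2)) := by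
  have hκ0 := h.gap_nonneg
  have hκ1 : 0 < 1 - κ := by linarith [h.gap_lt_one]
  have hR : 0 < b - a := by linarith
  -- The minimizer of the Chernoff exponent -st + (1+κ)/(1-κ)·s²(b-a)²/8.
  set s := 4 * t * ((1 - κ) / (1 + κ)) / (b - a) ^ 2 with hs
  have hs0 : 0 < s := by positivity
  have hm := h.exp_moment_le (g := fun x => s * f x) (a := s * a) (b := s * b)
    (by nlinarith) (by positivity)
    (fun x => ⟨mul_le_mul_of_nonneg_left (hf x).1 hs0.le,
      mul_le_mul_of_nonneg_left (hf x).2 hs0.le⟩)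
    (by
      have : ∀ x, π x * (s * f x) = s * (π x * f x) := fun x => by ring
      simp only [this, ← Finset.mul_sum, hf0, mul_zero]) k
  have h1 : (∑ x ∈ A, pathWeight π K x) * Real.exp (s * ((k + 1) * t)) ≤
      Real.exp ((k + 1) * ((1 + κ) / (1 - κ) * ((s * b - s * a) ^ 2 / 8))) := by
    refine le_trans ?_ hm
    rw [Finset.sum_mul]
    refine (Finset.sum_le_sum fun x hx => ?_).trans (Finset.sum_le_sum_of_subset_of_nonneg
      (Finset.subset_univ A) fun x _ _ => ?_)
    · refine mul_le_mul_of_nonneg_left ?_ (h.pathWeight_nonneg (fun s => (h.pos s).le) x)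
      rw [← Real.exp_sum, ← Finset.mul_sum]
      exact Real.exp_le_exp.2 (mul_le_mul_of_nonneg_left (hA x hx) hs0.le)
    · exact mul_nonneg (h.pathWeight_nonneg (fun s => (h.pos s).le) x)
        (Finset.prod_nonneg fun _ _ => (Real.exp_pos _).le)
  rw [← le_div_iff₀ (Real.exp_pos _), ← Real.exp_sub] at h1
  refine h1.trans (Real.exp_le_exp.2 (le_of_eq ?_))
  rw [hs]
  field_simp
  ring

/-- Hoeffding bound for a reversible chain with initial density `q`. -/
theorem tail_le (h : IsReversibleGap π K κ) {q : S → ℝ} {f : S → ℝ}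
    {a b t : ℝ} (ha : a < 0) (hb : 0 < b) (hf : ∀ s, f s ∈ Set.Icc a b)
    (hf0 : ∑ s, π s * f s = 0) (ht : 0 < t) (k : ℕ)
    (A : Finset (Fin (k + 1) → S)) (hA : ∀ x ∈ A, (k + 1) * t ≤ ∑ i, f (x i)) :
    ∑ x ∈ A, pathWeight q K x ≤ √(∑ s, q s ^ 2 / π s) *
      Real.exp (-((k + 1) * ((1 - κ) / (1 + κ)) * t ^ 2 / (b - a) ^ 2)) := by
  have hst := h.stationary_tail_le ha hb hf hf0 ht k A hA
  have hw0 := fun x : Fin (k + 1) → S => h.pathWeight_nonneg (fun s => (h.pos s).le) x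
  have hw1 : ∀ x : Fin (k + 1) → S, 0 ≤ pathWeight (fun s => q s ^ 2 / π s) K x := fun x =>
    h.pathWeight_nonneg (fun s => div_nonneg (sq_nonneg _) (h.pos s).le) x
  -- The squared path weight from q is the product of the path weights from q²/π and from π. The
  -- former have total mass β₁²; the square root of the latter halves the exponent.
  have cs : (∑ x ∈ A, pathWeight q K x) ^ 2 ≤
      (∑ x ∈ A, pathWeight (fun s => q s ^ 2 / π s) K x) * ∑ x ∈ A, pathWeight π K x := by
    refine Finset.sum_sq_le_sum_mul_sum_of_sq_le_mul _ (fun x _ => hw1 x) (fun x _ => hw0 x)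
      (fun x _ => ?_)
    have := (h.pos (x 0)).ne'
    simp only [pathWeight]
    refine le_of_eq ?_
    field_simp
  have h1 : ∑ x ∈ A, pathWeight (fun s => q s ^ 2 / π s) K x ≤ ∑ s, q s ^ 2 / π s := by
    rw [← h.sum_pathWeight (fun s => q s ^ 2 / π s) k]
    exact Finset.sum_le_sum_of_subset_of_nonneg (Finset.subset_univ A) fun x _ _ => hw1 x
  refine (Real.le_sqrt_of_sq_le (cs.trans (mul_le_mul h1 hst (Finset.sum_nonneg fun x _ => hw0 x)
    ?_))).trans (le_of_eq ?_)
  · exact Finset.sum_nonneg fun s _ => div_nonneg (sq_nonneg _) (h.pos s).le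
  · rw [Real.sqrt_mul (Finset.sum_nonneg fun s _ => div_nonneg (sq_nonneg _) (h.pos s).le),
      Real.sqrt_eq_rpow (Real.exp _), ← Real.exp_mul]
    congr 2
    ring

end IsReversibleGap

end Chain

/-! ### Spectral gap of reversible chains -/

section Spectral

variable {S : Type*} [Fintype S] [DecidableEq S]

theorem mem_spectrum_iff_exists_mulVec {K : Matrix S S ℝ} {ρ : ℝ} :
    ρ ∈ spectrum ℝ K ↔ ∃ v : S → ℝ, v ≠ 0 ∧ K.mulVec v = ρ • v := by
  rw [← Matrix.spectrum_toLin', ← Module.End.hasEigenvalue_iff_mem_spectrum]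
  constructor
  · intro h
    obtain ⟨v, hv⟩ := h.exists_hasEigenvector
    exact ⟨v, hv.2, by simpa using hv.apply_eq_smul⟩
  · rintro ⟨v, hv, h⟩
    exact Module.End.hasEigenvalue_of_hasEigenvector (x := v)
      ⟨by rw [Module.End.mem_eigenspace_iff]; simpa using h, hv⟩

/-- Gershgorin's argument at a coordinate where |v| is maximal gives |ρ - K_ss| ≤ 1 - K_ss; the
positive diagonal excludes ρ = -1. -/
theorem abs_lt_one_of_mulVec_eq {K : Matrix S S ℝ} (hK : ∀ s t, 0 ≤ K s t)
    (hrow : ∀ s, ∑ t, K s t = 1) (hdiag : ∀ s, 0 < K s s) {ρ : ℝ} (hρ : ρ ≠ 1) {v : S → ℝ}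
    (hv : v ≠ 0) (h : K.mulVec v = ρ • v) : |ρ| < 1 := by
  obtain ⟨s0, hs0⟩ := Function.ne_iff.1 hv
  obtain ⟨s, -, hs⟩ := Finset.exists_max_image Finset.univ (fun s => |v s|) ⟨s0, Finset.mem_univ _⟩
  have hpos : 0 < |v s| := lt_of_lt_of_le (abs_pos.2 hs0) (hs s0 (Finset.mem_univ _))
  have h1 : ∑ t, K s t * v t = ρ * v s := by simpa [Matrix.mulVec, dotProduct] using congrFun h s
  have h2 := hrow s
  rw [← Finset.add_sum_erase _ _ (Finset.mem_univ s)] at h1 h2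
  have h3 : |(ρ - K s s) * v s| ≤ (1 - K s s) * |v s| := by
    rw [show (ρ - K s s) * v s = ∑ t ∈ Finset.univ.erase s, K s t * v t by linarith,
      show 1 - K s s = ∑ t ∈ Finset.univ.erase s, K s t by linarith, Finset.sum_mul]
    refine (Finset.abs_sum_le_sum_abs _ _).trans (Finset.sum_le_sum fun t _ => ?_)
    rw [abs_mul, abs_of_nonneg (hK s t)]
    exact mul_le_mul_of_nonneg_left (hs t (Finset.mem_univ _)) (hK s t)
  rw [abs_mul] at h3
  have h4 := abs_le.1 (le_of_mul_le_mul_right h3 hpos)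
  have h5 := hdiag s
  rw [abs_lt]
  exact ⟨by linarith, lt_of_le_of_ne (by linarith) hρ⟩

/-- A symmetric matrix whose eigenvalues are bounded by `κ` has its form bounded by `κ`. -/
theorem abs_form_le_of_eigenvalues {N : Matrix S S ℝ} (hN : N.IsHermitian) {κ : ℝ}
    (h : ∀ (l : ℝ) (v : S → ℝ), v ≠ 0 → N.mulVec v = l • v → |l| ≤ κ) (v : S → ℝ) :
    |v ⬝ᵥ N.mulVec v| ≤ κ * (v ⬝ᵥ v) := by
  -- For either sign σ, the matrix κI - σN has nonnegative eigenvalues and is therefore positive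
  -- semidefinite.
  have key : ∀ σ : ℝ, σ * σ = 1 → 0 ≤ κ * (v ⬝ᵥ v) - σ * (v ⬝ᵥ N.mulVec v) := by
    intro σ hσ
    have hH : (κ • (1 : Matrix S S ℝ) - σ • N).IsHermitian := by
      refine Matrix.IsHermitian.sub ?_ ?_
      · rw [Matrix.IsHermitian, Matrix.conjTranspose_smul]; simp
      · rw [Matrix.IsHermitian, Matrix.conjTranspose_smul, hN.eq]; simp
    have hP : (κ • (1 : Matrix S S ℝ) - σ • N).PosSemidef := by
      rw [hH.posSemidef_iff_eigenvalues_nonneg]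
      intro i
      have h1 := hH.mulVec_eigenvectorBasis i
      rw [Matrix.sub_mulVec, Matrix.smul_mulVec, Matrix.smul_mulVec, Matrix.one_mulVec] at h1
      set μ := hH.eigenvalues i
      set w : S → ℝ := (hH.eigenvectorBasis i).ofLp with hw
      have hw0 : w ≠ 0 := by
        intro h0
        have := hH.eigenvectorBasis.orthonormal.ne_zero i
        apply this
        ext j
        exact congrFun h0 j
      have h2 : N.mulVec w = (σ * (κ - μ)) • w := by
        have : σ • (σ • N.mulVec w) = σ • (κ • w - μ • w) := by
          rw [← h1]; simp
        rw [smul_smul, hσ, one_smul] at this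
        rw [this, ← sub_smul, smul_smul]
      have h3 := h _ w hw0 h2
      have h4 : |σ| = 1 := by
        have : |σ| * |σ| = 1 := by rw [← abs_mul, hσ, abs_one]
        nlinarith [abs_nonneg σ]
      rw [abs_mul, h4, one_mul] at h3
      have := le_of_abs_le h3
      simp only [Pi.zero_apply]
      linarith
    have := hP.dotProduct_mulVec_nonneg v
    rw [Matrix.sub_mulVec, Matrix.smul_mulVec, Matrix.smul_mulVec, Matrix.one_mulVec] at this
    simpa [dotProduct_sub, dotProduct_smul] using this
  have h1 := key 1 (by norm_num)
  have h2 := key (-1) (by norm_num)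
  rw [abs_le]
  constructor <;> linarith

/-- Conjugation by √π symmetrizes K, and subtracting the projection onto √π removes the constants.
Nonzero eigenvalues of the result belong to mean zero eigenfunctions of K, and such a function
cannot have eigenvalue 1 because invariant functions are constant. The symmetric form bound for u -
∫u then gives the domination. -/
theorem isReversibleGap_of_spectrum {π : S → ℝ} {K : Matrix S S ℝ} {κ : ℝ} (hpos : ∀ s, 0 < π s)
    (hsum : ∑ s, π s = 1) (hK : ∀ s t, 0 ≤ K s t) (hrow : ∀ s, ∑ t, K s t = 1)
    (hrev : ∀ s t, π s * K s t = π t * K t s) (hκ0 : 0 ≤ κ) (hκ1 : κ < 1)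
    (hirr : ∀ v : S → ℝ, K.mulVec v = v → ∀ s t, v s = v t)
    (hspec : ∀ ρ ∈ spectrum ℝ K, ρ ≠ 1 → |ρ| ≤ κ) : IsReversibleGap π K κ := by
  refine ⟨hpos, hsum, hK, hrow, hrev, hκ0, hκ1, fun u => ?_⟩
  obtain ⟨σ, hs0, hs2⟩ : ∃ σ : S → ℝ, (∀ s, σ s ≠ 0) ∧ ∀ s, σ s * σ s = π s :=
    ⟨fun s => √(π s), fun s => (Real.sqrt_pos.2 (hpos s)).ne',
      fun s => Real.mul_self_sqrt (hpos s).le⟩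
  set N : Matrix S S ℝ := fun s t => σ s * K s t / σ t - σ s * σ t with hN
  have hNv : ∀ (w : S → ℝ) (s : S), N.mulVec (fun t => σ t * w t) s =
      σ s * (K.mulVec w s - ∑ t, π t * w t) := by
    intro w s
    simp only [hN, Matrix.mulVec, dotProduct, Finset.mul_sum, mul_sub, ← Finset.sum_sub_distrib]
    refine Finset.sum_congr rfl fun t _ => ?_
    rw [← hs2 t]
    have := hs0 t
    field_simp
  have hHerm : N.IsHermitian := by
    refine Matrix.IsHermitian.ext fun s t => ?_
    rw [star_trivial]
    simp only [hN]
    have h1 := hrev s t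
    rw [← hs2 s, ← hs2 t] at h1
    have := hs0 t
    have := hs0 s
    field_simp
    linear_combination -h1
  have hstat : ∀ w : S → ℝ, ∑ s, π s * K.mulVec w s = ∑ s, π s * w s := by
    intro w
    simp only [Matrix.mulVec, dotProduct, Finset.mul_sum]
    rw [Finset.sum_comm]
    refine Finset.sum_congr rfl fun t _ => ?_
    calc ∑ s, π s * (K s t * w t) = ∑ s, π t * w t * K t s :=
          Finset.sum_congr rfl fun s _ => by linear_combination w t * hrev s t
      _ = _ := by rw [← Finset.mul_sum, hrow, mul_one]
  have heig : ∀ (l : ℝ) (v : S → ℝ), v ≠ 0 → N.mulVec v = l • v → |l| ≤ κ := by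
    intro l v hv0 hv
    by_cases hl : l = 0
    · rw [hl, abs_zero]; exact hκ0
    set w : S → ℝ := fun t => v t / σ t with hw
    have hvw : v = fun t => σ t * w t := by
      funext t
      simp only [hw]
      rw [mul_div_cancel₀ _ (hs0 t)]
    have e : ∀ s, K.mulVec w s - ∑ t, π t * w t = l * w s := by
      intro s
      have h1 := hNv w s
      rw [← hvw, hv, Pi.smul_apply, smul_eq_mul, congrFun hvw s] at h1
      have := hs0 s
      apply mul_left_cancel₀ this
      linarith
    have hz : ∑ t, π t * w t = 0 := by
      have h1 : ∑ s, π s * (K.mulVec w s - ∑ t, π t * w t) = ∑ s, π s * (l * w s) :=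
        Finset.sum_congr rfl fun s _ => by rw [e s]
      simp only [mul_sub, Finset.sum_sub_distrib, ← Finset.sum_mul, hsum, hstat] at h1
      have h2 : ∑ s, π s * (l * w s) = l * ∑ s, π s * w s := by
        rw [Finset.mul_sum]
        exact Finset.sum_congr rfl fun s _ => by ring
      rw [h2] at h1
      have : l * ∑ s, π s * w s = 0 := by linarith
      exact (mul_eq_zero.1 this).resolve_left hl
    have hKw : K.mulVec w = l • w := by
      funext s
      have := e s
      rw [hz] at this
      simpa using this
    have hw0 : w ≠ 0 := by
      intro h0
      apply hv0
      rw [hvw, h0]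
      funext t
      simp
    refine hspec l (mem_spectrum_iff_exists_mulVec.2 ⟨w, hw0, hKw⟩) ?_
    rintro rfl
    rw [one_smul] at hKw
    have hc := hirr w hKw
    apply hw0
    funext s
    have : ∑ t, π t * w t = w s := by
      calc ∑ t, π t * w t = ∑ t, π t * w s := Finset.sum_congr rfl fun t _ => by rw [hc t s]
        _ = _ := by rw [← Finset.sum_mul, hsum, one_mul]
    rw [← this, hz, Pi.zero_apply]
  set m := ∑ s, π s * u s with hm
  have hb := abs_form_le_of_eigenvalues hHerm heig fun t => σ t * (u t - m)
  have hcent : ∑ t, π t * (u t - m) = 0 := by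
    simp only [mul_sub, Finset.sum_sub_distrib, ← Finset.sum_mul, hsum, ← hm]
    ring
  have hKc : ∀ s, K.mulVec (fun t => u t - m) s = K.mulVec u s - m := by
    intro s
    simp only [Matrix.mulVec, dotProduct, mul_sub, Finset.sum_sub_distrib, ← Finset.sum_mul, hrow,
      one_mul]
  have e1 : (fun t => σ t * (u t - m)) ⬝ᵥ N.mulVec (fun t => σ t * (u t - m)) =
      ∑ s, π s * (u s * K.mulVec u s) - m ^ 2 := by
    have h1 : ∀ s, σ s * (u s - m) * (σ s * (K.mulVec u s - m - 0)) =
        π s * (u s * K.mulVec u s) - m * (π s * u s) - m * (π s * K.mulVec u s) + m ^ 2 * π s := by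
      intro s
      rw [← hs2 s]; ring
    simp only [dotProduct, hNv, hcent, hKc, h1, Finset.sum_add_distrib, Finset.sum_sub_distrib,
      ← Finset.mul_sum, hstat, hsum, ← hm]
    ring
  have e2 : (fun t => σ t * (u t - m)) ⬝ᵥ (fun t => σ t * (u t - m)) =
      ∑ s, π s * u s ^ 2 - m ^ 2 := by
    have h1 : ∀ s, σ s * (u s - m) * (σ s * (u s - m)) =
        π s * u s ^ 2 - 2 * m * (π s * u s) + m ^ 2 * π s := by
      intro s
      rw [← hs2 s]; ring
    simp only [dotProduct, h1, Finset.sum_add_distrib, Finset.sum_sub_distrib,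
      ← Finset.mul_sum, hsum, ← hm]
    ring
  rw [e1, e2, abs_le] at hb
  rw [abs_le]
  have := sq_nonneg m
  constructor <;> nlinarith

end Spectral

/-! ### The Gibbs sampler -/

section Gibbs

variable {d : ℕ}

theorem normConst_pos (θ : Param d) : 0 < normConst θ :=
  Finset.sum_pos (fun _ _ => Real.exp_pos _) Finset.univ_nonempty

theorem isingDensity_pos (θ : Param d) (y : Config d) : 0 < isingDensity θ y :=
  div_pos (Real.exp_pos _) (normConst_pos θ)

theorem sum_isingDensity (θ : Param d) : ∑ y, isingDensity θ y = 1 := by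
  simp only [isingDensity, ← Finset.sum_div]
  exact div_self (normConst_pos θ).ne'

theorem gibbsProb_pos (ψ : Param d) (y : Config d) (r : Fin d) (v : ℤˣ) : 0 < gibbsProb ψ y r v :=
  div_pos (Real.exp_pos _) (add_pos (Real.exp_pos _) (Real.exp_pos _))

theorem sum_units_int (f : ℤˣ → ℝ) : ∑ v, f v = f 1 + f (-1) := by
  rw [show (Finset.univ : Finset ℤˣ) = {1, -1} from rfl, Finset.sum_pair (by decide)]

theorem sum_gibbsProb (ψ : Param d) (y : Config d) (r : Fin d) : ∑ v, gibbsProb ψ y r v = 1 := by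
  rw [sum_units_int]
  simp only [gibbsProb]
  rw [← add_div]
  exact div_self (add_pos (Real.exp_pos _) (Real.exp_pos _)).ne'

theorem gibbsKernel_mulVec (ψ : Param d) (u : Config d → ℝ) (y : Config d) :
    (gibbsKernel ψ).mulVec u y =
      (1 / (d : ℝ)) * ∑ r, ∑ v, gibbsProb ψ y r v * u (Function.update y r v) := by
  simp only [Matrix.mulVec, dotProduct, gibbsKernel]
  simp only [mul_assoc, ← Finset.mul_sum, Finset.sum_mul]
  congr 1
  rw [Finset.sum_comm]
  refine Finset.sum_congr rfl fun r _ => ?_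
  rw [Finset.sum_comm]
  refine Finset.sum_congr rfl fun v _ => ?_
  simp

theorem gibbsKernel_nonneg (ψ : Param d) (y z : Config d) : 0 ≤ gibbsKernel ψ y z := by
  refine mul_nonneg (by positivity) (Finset.sum_nonneg fun r _ => Finset.sum_nonneg fun v _ => ?_)
  split_ifs
  · exact (gibbsProb_pos ψ y r v).le
  · exact le_rfl

theorem gibbsKernel_row_sum (hd : 0 < d) (ψ : Param d) (y : Config d) :
    ∑ z, gibbsKernel ψ y z = 1 := by
  have h := gibbsKernel_mulVec ψ (fun _ => 1) y
  simp only [Matrix.mulVec, dotProduct, mul_one, sum_gibbsProb] at h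
  rw [h]
  have : (d : ℝ) ≠ 0 := by positivity
  simp [this]

theorem gibbsKernel_diag_pos (hd : 0 < d) (ψ : Param d) (y : Config d) :
    0 < gibbsKernel ψ y y := by
  have hd' : (0 : ℝ) < d := by exact_mod_cast hd
  refine mul_pos (by positivity) ?_
  have hnn : ∀ (r : Fin d) (v : ℤˣ),
      0 ≤ if y = Function.update y r v then gibbsProb ψ y r v else 0 := by
    intro r v
    split_ifs
    · exact (gibbsProb_pos ψ y r v).le
    · exact le_rfl
  refine Finset.sum_pos (fun r _ => ?_) ⟨⟨0, hd⟩, Finset.mem_univ _⟩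
  refine Finset.sum_pos' (fun v _ => hnn r v) ⟨y r, Finset.mem_univ _, ?_⟩
  rw [Function.update_eq_self, if_pos rfl]
  exact gibbsProb_pos ψ y r (y r)

/-- Two configurations joined by an update at r share the normalizing denominator of the conditional
law; otherwise both sides vanish. -/
theorem gibbsProb_reversible (ψ : Param d) (y z : Config d) (r : Fin d) :
    isingDensity ψ y * (∑ v, if z = Function.update y r v then gibbsProb ψ y r v else 0) =
      isingDensity ψ z * ∑ v, if y = Function.update z r v then gibbsProb ψ z r v else 0 := by
  have key : ∀ y z : Config d, (∃ v, z = Function.update y r v) →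
      (∑ v, if z = Function.update y r v then gibbsProb ψ y r v else 0) = gibbsProb ψ y r (z r) := by
    rintro y z ⟨w, rfl⟩
    rw [Finset.sum_eq_single w]
    · simp
    · intro v _ hv
      rw [if_neg]
      intro h
      apply hv
      have := congrFun h r
      simpa using this.symm
    · exact fun h => absurd (Finset.mem_univ _) h
  have hz : ∀ y z : Config d, ¬ (∃ v, z = Function.update y r v) →
      (∑ v, if z = Function.update y r v then gibbsProb ψ y r v else 0) = 0 := by
    intro y z h
    refine Finset.sum_eq_zero fun v _ => if_neg fun hv => h ⟨v, hv⟩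
  have hsymm : ∀ y z : Config d, (∃ v, z = Function.update y r v) →
      ∃ v, y = Function.update z r v := by
    rintro y z ⟨v, rfl⟩
    exact ⟨y r, by simp⟩
  by_cases h : ∃ v, z = Function.update y r v
  · rw [key y z h, key z y (hsymm y z h)]
    obtain ⟨v, rfl⟩ := h
    simp only [isingDensity, gibbsProb, Function.update_idem, Function.update_self,
      Function.update_eq_self]
    ring
  · rw [hz y z h, hz z y fun h' => h (hsymm z y h'), mul_zero, mul_zero]

theorem gibbsKernel_reversible (ψ : Param d) (y z : Config d) :
    isingDensity ψ y * gibbsKernel ψ y z = isingDensity ψ z * gibbsKernel ψ z y := by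
  simp only [gibbsKernel]
  rw [mul_left_comm, mul_left_comm (isingDensity ψ z)]
  congr 1
  rw [Finset.mul_sum, Finset.mul_sum]
  exact Finset.sum_congr rfl fun r _ => gibbsProb_reversible ψ y z r

/-- Maximum principle: an average equal to the maximum forces the maximal value after every
single-site update, and any configuration is reached by changing vertices one at a time. -/
theorem gibbsKernel_irreducible (hd : 0 < d) (ψ : Param d) (u : Config d → ℝ)
    (h : (gibbsKernel ψ).mulVec u = u) (y z : Config d) : u y = u z := by
  have hd' : (d : ℝ) ≠ 0 := by positivity
  obtain ⟨y0, -, hy0⟩ := Finset.exists_max_image Finset.univ u ⟨y, Finset.mem_univ _⟩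
  have step : ∀ x, u x = u y0 → ∀ r v, u (Function.update x r v) = u y0 := by
    intro x hx r v
    have h1 := congrFun h x
    rw [gibbsKernel_mulVec] at h1
    have h2 : ∑ r, ∑ v, gibbsProb ψ x r v * (u y0 - u (Function.update x r v)) = 0 := by
      simp only [mul_sub, Finset.sum_sub_distrib, ← Finset.sum_mul, sum_gibbsProb]
      simp only [Finset.sum_const, Finset.card_univ, Fintype.card_fin, nsmul_eq_mul]
      rw [← hx]
      nth_rewrite 1 [← h1]
      field_simp
      ring
    have hnn : ∀ r v, 0 ≤ gibbsProb ψ x r v * (u y0 - u (Function.update x r v)) := fun r v =>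
      mul_nonneg (gibbsProb_pos ψ x r v).le (sub_nonneg.2 (hy0 _ (Finset.mem_univ _)))
    have h3 := (Finset.sum_eq_zero_iff_of_nonneg fun r _ =>
      Finset.sum_nonneg fun v _ => hnn r v).1 h2 r (Finset.mem_univ _)
    have h4 := (Finset.sum_eq_zero_iff_of_nonneg fun v _ => hnn r v).1 h3 v (Finset.mem_univ _)
    have := (mul_eq_zero.1 h4).resolve_left (gibbsProb_pos ψ x r v).ne'
    linarith
  have all : ∀ x : Config d, u x = u y0 := by
    intro x
    have : ∀ s : Finset (Fin d), u (s.piecewise x y0) = u y0 := by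
      intro s
      induction s using Finset.induction_on with
      | empty => simp
      | insert i s _ ih =>
        rw [Finset.piecewise_insert]
        exact step _ ih _ _
    simpa using this Finset.univ
  rw [all y, all z]

theorem isReversibleGap_gibbsKernel (hd : 0 < d) (ψ : Param d) :
    IsReversibleGap (isingDensity ψ) (gibbsKernel ψ) (kappa (gibbsKernel ψ)) := by
  have hset : {a | ∃ ρ ∈ spectrum ℝ (gibbsKernel ψ), ρ ≠ 1 ∧ a = |ρ|} =
      (fun ρ => |ρ|) '' {ρ | ρ ∈ spectrum ℝ (gibbsKernel ψ) ∧ ρ ≠ 1} := by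
    ext a
    constructor
    · rintro ⟨ρ, h1, h2, rfl⟩
      exact ⟨ρ, ⟨h1, h2⟩, rfl⟩
    · rintro ⟨ρ, ⟨h1, h2⟩, rfl⟩
      exact ⟨ρ, h1, h2, rfl⟩
  have hfin : {a | ∃ ρ ∈ spectrum ℝ (gibbsKernel ψ), ρ ≠ 1 ∧ a = |ρ|}.Finite := by
    rw [hset]
    exact ((Matrix.finite_real_spectrum (A := gibbsKernel ψ)).subset fun ρ h => h.1).image _
  refine isReversibleGap_of_spectrum (isingDensity_pos ψ) (sum_isingDensity ψ)
    (gibbsKernel_nonneg ψ) (gibbsKernel_row_sum hd ψ) (gibbsKernel_reversible ψ) ?_ ?_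
    (gibbsKernel_irreducible hd ψ) fun ρ hρ h1 => ?_
  · refine Real.sSup_nonneg ?_
    rintro a ⟨ρ, -, -, rfl⟩
    exact abs_nonneg _
  · rcases Set.eq_empty_or_nonempty
      {a | ∃ ρ ∈ spectrum ℝ (gibbsKernel ψ), ρ ≠ 1 ∧ a = |ρ|} with he | hne
    -- With no eigenvalue other than 1, κ takes the default value 0 of `sSup ∅`.
    · rw [kappa, he, Real.sSup_empty]
      exact one_pos
    · obtain ⟨ρ, h1, h2, h3⟩ := hne.csSup_mem hfin
      rw [kappa, h3]
      obtain ⟨v, hv, hKv⟩ := mem_spectrum_iff_exists_mulVec.1 h1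
      exact abs_lt_one_of_mulVec_eq (gibbsKernel_nonneg ψ) (gibbsKernel_row_sum hd ψ)
        (gibbsKernel_diag_pos hd ψ) h2 hv hKv
  · exact le_csSup hfin.bddAbove ⟨ρ, hρ, h1, rfl⟩

end Gibbs

/-! ### Weighted means and the log-sum-exp function -/

section Weighted

variable {ι : Type*} [Fintype ι]

/-- The mean of `f` under the weights `W`. -/
def wmean (W f : ι → ℝ) : ℝ := (∑ k, W k * f k) / ∑ k, W k

/-- The variance of `f` under the weights `W`. -/
def wvar (W f : ι → ℝ) : ℝ := wmean W fun k => (f k - wmean W f) ^ 2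

/-- The covariance matrix of the vectors `j k` under the weights `W`. -/
def wcov {d : ℕ} (W : ι → ℝ) (j : ι → Param d) : Matrix (Pair d) (Pair d) ℝ := fun e e' =>
  wmean W (fun k => j k e * j k e') - wmean W (fun k => j k e) * wmean W fun k => j k e'

variable {W : ι → ℝ}

theorem wmean_sum {E : Type*} (s : Finset E) (f : E → ι → ℝ) :
    wmean W (fun k => ∑ e ∈ s, f e k) = ∑ e ∈ s, wmean W (f e) := by
  simp only [wmean, ← Finset.sum_div, Finset.mul_sum]
  rw [Finset.sum_comm]

theorem wmean_const_mul (c : ℝ) (f : ι → ℝ) : wmean W (fun k => c * f k) = c * wmean W f := by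
  simp only [wmean, mul_div_assoc', Finset.mul_sum]
  congr 1
  exact Finset.sum_congr rfl fun k _ => by ring

theorem wmean_sub (f g : ι → ℝ) : wmean W (fun k => f k - g k) = wmean W f - wmean W g := by
  simp only [wmean, mul_sub, Finset.sum_sub_distrib, sub_div]

theorem wmean_add (f g : ι → ℝ) : wmean W (fun k => f k + g k) = wmean W f + wmean W g := by
  simp only [wmean, mul_add, Finset.sum_add_distrib, add_div]

theorem wmean_const (hs : ∑ k, W k ≠ 0) (c : ℝ) : wmean W (fun _ => c) = c := by
  simp only [wmean, ← Finset.sum_mul]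
  field_simp

theorem wmean_mono (hW : ∀ k, 0 ≤ W k) {f g : ι → ℝ} (h : ∀ k, f k ≤ g k) :
    wmean W f ≤ wmean W g := by
  refine div_le_div_of_nonneg_right ?_ (Finset.sum_nonneg fun k _ => hW k)
  exact Finset.sum_le_sum fun k _ => mul_le_mul_of_nonneg_left (h k) (hW k)

theorem abs_wmean_le (hW : ∀ k, 0 ≤ W k) (hs : ∑ k, W k ≠ 0) {f : ι → ℝ} {c : ℝ}
    (h : ∀ k, |f k| ≤ c) : |wmean W f| ≤ c := by
  rw [abs_le]
  have h1 := wmean_mono hW fun k => (abs_le.1 (h k)).1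
  have h2 := wmean_mono hW fun k => (abs_le.1 (h k)).2
  rw [wmean_const hs] at h1 h2
  exact ⟨h1, h2⟩

theorem wmean_sub_sq (hs : ∑ k, W k ≠ 0) (f : ι → ℝ) (c : ℝ) :
    wmean W (fun k => (f k - c) ^ 2) = wmean W (fun k => f k ^ 2) - 2 * c * wmean W f + c ^ 2 := by
  have : (fun k => (f k - c) ^ 2) = fun k => (f k ^ 2 - 2 * c * f k) + c ^ 2 := by
    funext k; ring
  rw [this, wmean_add, wmean_sub, wmean_const_mul, wmean_const hs]

theorem wvar_eq (hs : ∑ k, W k ≠ 0) (f : ι → ℝ) :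
    wvar W f = wmean W (fun k => f k ^ 2) - wmean W f ^ 2 := by
  rw [wvar, wmean_sub_sq hs]; ring

theorem wvar_le (hs : ∑ k, W k ≠ 0) (f : ι → ℝ) (c : ℝ) :
    wvar W f ≤ wmean W fun k => (f k - c) ^ 2 := by
  rw [wvar_eq hs, wmean_sub_sq hs]
  nlinarith [sq_nonneg (wmean W f - c)]

theorem wvar_nonneg (hW : ∀ k, 0 ≤ W k) (f : ι → ℝ) : 0 ≤ wvar W f :=
  div_nonneg (Finset.sum_nonneg fun k _ => mul_nonneg (hW k) (sq_nonneg _))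
    (Finset.sum_nonneg fun k _ => hW k)

theorem wvar_dotProduct {d : ℕ} (hs : ∑ k, W k ≠ 0) (j : ι → Param d) (Δ : Param d) :
    wvar W (fun k => Δ ⬝ᵥ j k) = ∑ e, ∑ e', Δ e * Δ e' * wcov W j e e' := by
  have h1 : wmean W (fun k => Δ ⬝ᵥ j k) = ∑ e, Δ e * wmean W fun k => j k e := by
    simp only [dotProduct]
    rw [wmean_sum]
    simp only [wmean_const_mul]
  have h2 : wmean W (fun k => (Δ ⬝ᵥ j k) ^ 2) =
      ∑ e, ∑ e', Δ e * Δ e' * wmean W fun k => j k e * j k e' := by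
    have : (fun k => (Δ ⬝ᵥ j k) ^ 2) =
        fun k => ∑ e, ∑ e', Δ e * Δ e' * (j k e * j k e') := by
      funext k
      rw [pow_two, dotProduct, Finset.sum_mul_sum]
      exact Finset.sum_congr rfl fun e _ => Finset.sum_congr rfl fun e' _ => by ring
    rw [this, wmean_sum]
    refine Finset.sum_congr rfl fun e _ => ?_
    rw [wmean_sum]
    exact Finset.sum_congr rfl fun e' _ => wmean_const_mul _ _
  rw [wvar_eq hs, h1, h2, pow_two, Finset.sum_mul_sum, ← Finset.sum_sub_distrib]
  refine Finset.sum_congr rfl fun e _ => ?_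
  rw [← Finset.sum_sub_distrib]
  refine Finset.sum_congr rfl fun e' _ => ?_
  rw [wcov]; ring

theorem hasDerivAt_sum_exp (W a : ι → ℝ) (t : ℝ) :
    HasDerivAt (fun t => ∑ k, W k * Real.exp (t * a k))
      (∑ k, W k * Real.exp (t * a k) * a k) t := by
  refine HasDerivAt.fun_sum fun k _ => ?_
  have := (((hasDerivAt_id t).mul_const (a k)).exp).const_mul (W k)
  exact this.congr_deriv (by simp; ring)

variable [Nonempty ι]

theorem sum_weight_pos (hW : ∀ k, 0 < W k) : 0 < ∑ k, W k :=
  Finset.sum_pos (fun k _ => hW k) Finset.univ_nonempty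

/-- Jensen's inequality for the log-sum-exp function. -/
theorem wmean_le_log_sum_exp (hW : ∀ k, 0 < W k) (a : ι → ℝ) :
    Real.log (∑ k, W k) + wmean W a ≤ Real.log (∑ k, W k * Real.exp (a k)) := by
  have hs := sum_weight_pos hW
  have hs' : 0 < ∑ k, W k * Real.exp (a k) :=
    sum_weight_pos fun k => mul_pos (hW k) (Real.exp_pos _)
  rw [Real.le_log_iff_exp_le hs', Real.exp_add, Real.exp_log hs]
  set μ := wmean W a with hμ
  have h1 : ∑ k, W k * (Real.exp μ * (a k - μ + 1)) = (∑ k, W k) * Real.exp μ := by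
    have : ∑ k, W k * a k = μ * ∑ k, W k := by rw [hμ, wmean, div_mul_cancel₀ _ hs.ne']
    have h2 : ∀ k, W k * (Real.exp μ * (a k - μ + 1)) =
        Real.exp μ * (W k * a k) + Real.exp μ * (1 - μ) * W k := fun k => by ring
    simp only [h2, Finset.sum_add_distrib, ← Finset.mul_sum, this]
    ring
  rw [← h1]
  refine Finset.sum_le_sum fun k _ => mul_le_mul_of_nonneg_left ?_ (hW k).le
  have := mul_le_mul_of_nonneg_left (Real.add_one_le_exp (a k - μ)) (Real.exp_pos μ).le
  rwa [← Real.exp_add, add_sub_cancel] at this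

theorem hasDerivAt_log_sum_exp (hW : ∀ k, 0 < W k) (a : ι → ℝ) (t : ℝ) :
    HasDerivAt (fun t => Real.log (∑ k, W k * Real.exp (t * a k)))
      (wmean (fun k => W k * Real.exp (t * a k)) a) t :=
  (hasDerivAt_sum_exp W a t).log
    (sum_weight_pos fun k => mul_pos (hW k) (Real.exp_pos _)).ne'

theorem hasDerivAt_wmean (hW : ∀ k, 0 < W k) (a b : ι → ℝ) (t : ℝ) :
    HasDerivAt (fun t => wmean (fun k => W k * Real.exp (t * a k)) b)
      (wmean (fun k => W k * Real.exp (t * a k)) (fun k => a k * b k) -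
        wmean (fun k => W k * Real.exp (t * a k)) a *
          wmean (fun k => W k * Real.exp (t * a k)) b) t := by
  have hs := (sum_weight_pos fun k => mul_pos (hW k) (Real.exp_pos (t * a k))).ne'
  have h1 := hasDerivAt_sum_exp (fun k => W k * b k) a t
  have h2 := hasDerivAt_sum_exp W a t
  have := h1.div h2 hs
  have hf : (fun t => wmean (fun k => W k * Real.exp (t * a k)) b) =
      ((fun t => ∑ k, W k * b k * Real.exp (t * a k)) / fun t => ∑ k, W k * Real.exp (t * a k)) := by
    funext t
    simp only [wmean, Pi.div_apply]
    congr 1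
    exact Finset.sum_congr rfl fun k _ => by ring
  rw [hf]
  refine this.congr_deriv ?_
  simp only [wmean]
  have e1 : ∑ k, W k * b k * Real.exp (t * a k) * a k =
      ∑ k, W k * Real.exp (t * a k) * (a k * b k) := Finset.sum_congr rfl fun k _ => by ring
  have e2 : ∑ k, W k * b k * Real.exp (t * a k) =
      ∑ k, W k * Real.exp (t * a k) * b k := Finset.sum_congr rfl fun k _ => by ring
  rw [e1, e2]
  field_simp

theorem hasDerivAt_wmean_self (hW : ∀ k, 0 < W k) (a : ι → ℝ) (t : ℝ) :
    HasDerivAt (fun t => wmean (fun k => W k * Real.exp (t * a k)) a)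
      (wvar (fun k => W k * Real.exp (t * a k)) a) t := by
  refine (hasDerivAt_wmean hW a a t).congr_deriv ?_
  rw [wvar_eq (sum_weight_pos fun k => mul_pos (hW k) (Real.exp_pos (t * a k))).ne']
  simp only [pow_two]

/-- Self-concordance: tilting decreases the variance at most exponentially. -/
theorem exp_neg_mul_wvar_le (hW : ∀ k, 0 < W k) {a : ι → ℝ} {η t : ℝ}
    (ha : ∀ k l, a k - a l ≤ η) (ht : 0 ≤ t) :
    Real.exp (-(η * t)) * wvar W a ≤ wvar (fun k => W k * Real.exp (t * a k)) a := by
  have hs := sum_weight_pos hW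
  have hst : 0 < ∑ k, W k * Real.exp (t * a k) :=
    sum_weight_pos fun k => mul_pos (hW k) (Real.exp_pos (t * a k))
  -- Variance is minimal about its own mean, so the untilted variance may be centred at the tilted
  -- mean. Both sides then have the same integrand, and the normalized weights differ by a factor of
  -- at least e^{-ηt}.
  set c := wmean (fun k => W k * Real.exp (t * a k)) a with hc
  refine (mul_le_mul_of_nonneg_left (wvar_le hs.ne' a c) (Real.exp_pos _).le).trans ?_
  rw [wvar, ← hc]
  simp only [wmean]
  rw [mul_div_assoc', div_le_div_iff₀ hs hst, mul_assoc, Finset.sum_mul_sum, Finset.sum_mul_sum,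
    Finset.mul_sum]
  refine Finset.sum_le_sum fun k _ => ?_
  rw [Finset.mul_sum]
  refine Finset.sum_le_sum fun l _ => ?_
  have h1 : Real.exp (-(η * t)) * Real.exp (t * a l) ≤ Real.exp (t * a k) := by
    rw [← Real.exp_add]
    refine Real.exp_le_exp.2 ?_
    nlinarith [ha l k]
  have h2 : 0 ≤ W k * W l * (a k - c) ^ 2 :=
    mul_nonneg (mul_nonneg (hW k).le (hW l).le) (sq_nonneg _)
  nlinarith [mul_le_mul_of_nonneg_left h1 h2]

/-- Lower bound of the symmetric Bregman divergence of the log-sum-exp function. -/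
theorem bregman_ge (hW : ∀ k, 0 < W k) {a : ι → ℝ} {η : ℝ} (hη : 0 < η)
    (ha : ∀ k l, a k - a l ≤ η) :
    (1 - Real.exp (-η)) / η * wvar W a ≤
      wmean (fun k => W k * Real.exp (a k)) a - wmean W a := by
  set V := wvar W a with hV
  -- Adding an antiderivative of -Ve^{-ηt} makes the tilted mean monotone; comparing t = 0 and t = 1
  -- integrates the variance bound.
  have hd : ∀ t : ℝ, HasDerivAt
      (fun t => wmean (fun k => W k * Real.exp (t * a k)) a + V / η * Real.exp (-(η * t)))
      (wvar (fun k => W k * Real.exp (t * a k)) a - V * Real.exp (-(η * t))) t := by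
    intro t
    have h1 := (((hasDerivAt_id t).const_mul η).neg.exp).const_mul (V / η)
    refine ((hasDerivAt_wmean_self hW a t).add h1).congr_deriv ?_
    simp
    field_simp
    ring
  have hm : MonotoneOn
      (fun t => wmean (fun k => W k * Real.exp (t * a k)) a + V / η * Real.exp (-(η * t)))
      (Set.Ici 0) := by
    refine monotoneOn_of_deriv_nonneg (convex_Ici 0)
      (fun x _ => (hd x).continuousAt.continuousWithinAt)
      (fun x _ => (hd x).differentiableAt.differentiableWithinAt) fun x hx => ?_
    rw [(hd x).deriv]
    rw [interior_Ici] at hx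
    linarith [exp_neg_mul_wvar_le hW ha (le_of_lt hx : (0 : ℝ) ≤ x)]
  have := hm (Set.mem_Ici.2 le_rfl) (Set.mem_Ici.2 zero_le_one) zero_le_one
  simp only [zero_mul, Real.exp_zero, mul_one, mul_zero, neg_zero, one_mul] at this
  have e : (1 - Real.exp (-η)) / η * V = V / η - V / η * Real.exp (-η) := by ring
  rw [e]
  linarith

end Weighted

/-! ### Norms of parameter vectors -/

section Norms

variable {d : ℕ}

theorem l1On_nonneg (A : Finset (Pair d)) (θ : Param d) : 0 ≤ l1On A θ :=
  Finset.sum_nonneg fun _ _ => abs_nonneg _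

theorem l1On_add_compl (A : Finset (Pair d)) (θ : Param d) :
    l1On A θ + l1On Aᶜ θ = l1On Finset.univ θ :=
  Finset.sum_add_sum_compl A fun e => |θ e|

theorem abs_le_l1On (θ : Param d) (e : Pair d) : |θ e| ≤ l1On Finset.univ θ :=
  Finset.single_le_sum (f := fun e => |θ e|) (fun _ _ => abs_nonneg _) (Finset.mem_univ e)

theorem norm_le_l1On (θ : Param d) : ‖θ‖ ≤ l1On Finset.univ θ :=
  (pi_norm_le_iff_of_nonneg (l1On_nonneg _ _)).2 fun e => abs_le_l1On θ e

theorem l1On_le_card_mul (A : Finset (Pair d)) (θ : Param d) : l1On A θ ≤ A.card * ‖θ‖ := by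
  have : ∀ e ∈ A, |θ e| ≤ ‖θ‖ := fun e _ => norm_le_pi_norm θ e
  simpa [l1On] using Finset.sum_le_card_nsmul A _ _ this

theorem abs_dotProduct_le {Δ Z : Param d} {z : ℝ} (hZ : ∀ e, |Z e| ≤ z) :
    |Δ ⬝ᵥ Z| ≤ z * l1On Finset.univ Δ := by
  rw [dotProduct, l1On, Finset.mul_sum]
  refine (Finset.abs_sum_le_sum_abs _ _).trans (Finset.sum_le_sum fun e _ => ?_)
  rw [abs_mul, mul_comm]
  exact mul_le_mul_of_nonneg_right (hZ e) (abs_nonneg _)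

theorem abs_J (y : Config d) (e : Pair d) : |J y e| = 1 := by
  rw [J, abs_mul]
  rcases Int.units_eq_one_or (y e.1.1) with h | h <;>
    rcases Int.units_eq_one_or (y e.1.2) with h' | h' <;> rw [h, h'] <;> simp

theorem J_mul_self (y : Config d) (e : Pair d) : J y e * J y e = 1 := by
  rw [← abs_mul_abs_self, abs_J, one_mul]

theorem dotProduct_J_sub_le (Δ : Param d) (y z : Config d) :
    Δ ⬝ᵥ J y - Δ ⬝ᵥ J z ≤ 2 * l1On Finset.univ Δ := by
  have h1 := le_of_abs_le (abs_dotProduct_le (Δ := Δ) fun e => (abs_J y e).le)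
  have h2 := neg_le_of_abs_le (abs_dotProduct_le (Δ := Δ) fun e => (abs_J z e).le)
  linarith

/-- On the support this is the triangle inequality; off the support θs vanishes, so the penalty
there is exactly that of Δ. -/
theorem l1On_sub_le (θs Δ : Param d) :
    l1On Finset.univ θs - l1On Finset.univ (θs + Δ) ≤ l1On (supp θs) Δ - l1On (supp θs)ᶜ Δ := by
  rw [← l1On_add_compl (supp θs) θs, ← l1On_add_compl (supp θs) (θs + Δ)]
  have h1 : l1On (supp θs) θs - l1On (supp θs) (θs + Δ) ≤ l1On (supp θs) Δ := by
    simp only [l1On, ← Finset.sum_sub_distrib]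
    refine Finset.sum_le_sum fun e _ => ?_
    have := abs_sub_abs_le_abs_sub (θs e) (θs e + Δ e)
    simpa using this
  have hz : ∀ e ∈ (supp θs)ᶜ, θs e = 0 := by
    intro e he
    simpa [supp] using he
  have h2 : l1On (supp θs)ᶜ θs = 0 :=
    Finset.sum_eq_zero fun e he => by rw [hz e he, abs_zero]
  have h3 : l1On (supp θs)ᶜ (θs + Δ) = l1On (supp θs)ᶜ Δ :=
    Finset.sum_congr rfl fun e he => by rw [Pi.add_apply, hz e he, zero_add]
  rw [h2, h3]
  linarith

theorem continuous_l1On (A : Finset (Pair d)) : Continuous (l1On A) := by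
  unfold l1On
  fun_prop

end Norms

/-! ### The Fisher information and the cone invertibility factor -/

section Fisher

variable {d : ℕ}

/-- The unnormalized weights of the Ising model. -/
def isingWeight (θ : Param d) (y : Config d) : ℝ := Real.exp (θ ⬝ᵥ J y)

theorem isingWeight_pos (θ : Param d) (y : Config d) : 0 < isingWeight θ y := Real.exp_pos _

theorem sum_isingWeight (θ : Param d) : ∑ y, isingWeight θ y = normConst θ := rfl

theorem sum_isingWeight_ne_zero (θ : Param d) : ∑ y, isingWeight θ y ≠ 0 := (normConst_pos θ).ne'

theorem isingWeight_add_smul (θ Δ : Param d) (t : ℝ) (y : Config d) :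
    isingWeight (θ + t • Δ) y = isingWeight θ y * Real.exp (t * (Δ ⬝ᵥ J y)) := by
  rw [isingWeight, isingWeight, ← Real.exp_add, add_dotProduct, smul_dotProduct, smul_eq_mul]

theorem single_dotProduct_J (e : Pair d) (y : Config d) :
    (Pi.single e 1 : Param d) ⬝ᵥ J y = J y e := by
  simp

theorem differentiable_normConst : Differentiable ℝ (normConst (d := d)) := by
  unfold normConst dotProduct
  fun_prop

theorem differentiable_log_normConst :
    Differentiable ℝ fun θ : Param d => Real.log (normConst θ) := fun θ =>
  (differentiable_normConst θ).log (normConst_pos θ).ne'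

theorem fderiv_log_normConst (θ : Param d) (e : Pair d) :
    fderiv ℝ (fun θ : Param d => Real.log (normConst θ)) θ (Pi.single e 1) =
      wmean (isingWeight θ) fun y => J y e := by
  rw [← (differentiable_log_normConst θ).lineDeriv_eq_fderiv, lineDeriv]
  have h := hasDerivAt_log_sum_exp (isingWeight_pos θ) (fun y => J y e) 0
  simp only [zero_mul, Real.exp_zero, mul_one] at h
  rw [← h.deriv]
  congr 1
  funext t
  rw [← sum_isingWeight]
  simp only [isingWeight_add_smul, single_dotProduct_J]

theorem differentiable_wmean_isingWeight (f : Config d → ℝ) :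
    Differentiable ℝ fun θ : Param d => wmean (isingWeight θ) f := by
  have h1 : Differentiable ℝ fun θ : Param d => ∑ y, isingWeight θ y * f y := by
    unfold isingWeight dotProduct
    fun_prop
  change Differentiable ℝ fun θ : Param d => (∑ y, isingWeight θ y * f y) / normConst θ
  simp only [div_eq_mul_inv]
  exact h1.fun_mul (differentiable_normConst.fun_inv fun θ => (normConst_pos θ).ne')

theorem hessian_log_normConst (θ : Param d) :
    hessian (fun θ : Param d => Real.log (normConst θ)) θ = wcov (isingWeight θ) J := by
  funext e e'
  simp only [hessian, fderiv_log_normConst]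
  rw [← (differentiable_wmean_isingWeight _ θ).lineDeriv_eq_fderiv, lineDeriv]
  have h := hasDerivAt_wmean (isingWeight_pos θ) (fun y => J y e) (fun y => J y e') 0
  simp only [zero_mul, Real.exp_zero, mul_one] at h
  rw [wcov, ← h.deriv]
  congr 1
  funext t
  congr 1
  funext y
  rw [isingWeight_add_smul, single_dotProduct_J]

theorem hessian_form (θ Δ : Param d) :
    Δ ⬝ᵥ (hessian (fun θ : Param d => Real.log (normConst θ)) θ).mulVec Δ =
      wvar (isingWeight θ) fun y => Δ ⬝ᵥ J y := by
  rw [wvar_dotProduct (sum_isingWeight_ne_zero θ), hessian_log_normConst]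
  simp only [dotProduct, Matrix.mulVec, Finset.mul_sum]
  exact Finset.sum_congr rfl fun e _ => Finset.sum_congr rfl fun e' _ => by ring

/-- The mixed second difference in the two vertices of a pair isolates its coordinate. -/
theorem mixed_difference_J (e e' : Pair d) :
    J (Function.update (Function.update 1 e.1.1 1) e.1.2 1) e' -
      J (Function.update (Function.update 1 e.1.1 1) e.1.2 (-1)) e' -
      J (Function.update (Function.update 1 e.1.1 (-1)) e.1.2 1) e' +
      J (Function.update (Function.update 1 e.1.1 (-1)) e.1.2 (-1)) e' =
      if e' = e then 4 else 0 := by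
  obtain ⟨⟨r, s⟩, hrs⟩ := e
  obtain ⟨⟨a, b⟩, hab⟩ := e'
  simp only at hrs hab
  simp only [J, Subtype.mk.injEq, Prod.mk.injEq, Function.update_apply]
  by_cases h1 : a = r
  · subst h1
    have h3 : a ≠ s := hrs.ne
    have h4 : b ≠ a := hab.ne'
    by_cases h2 : b = s
    · subst h2
      simp [h3]
      norm_num
    · simp [h2, h3, h4]
  · by_cases h2 : a = s
    · subst h2
      have h3 : b ≠ a := hab.ne'
      have h4 : b ≠ r := (hrs.trans hab).ne'
      simp [h1, h3, h4]
    · by_cases h3 : b = s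
      · simp [h1, h2, h3]
      · by_cases h4 : b = r
        · simp [h1, h2, h4, hrs.ne]
        · simp [h1, h2, h3, h4]

/-- The mixed second difference over four configurations cancels μ and all other coordinates and
leaves 4Δ_e, so the four deviations cannot all be smaller than |Δ_e|. -/
theorem exists_abs_sub_ge (Δ : Param d) (e : Pair d) (μ : ℝ) :
    ∃ y : Config d, |Δ e| ≤ |Δ ⬝ᵥ J y - μ| := by
  by_contra hcon
  push Not at hcon
  set y1 : Config d := Function.update (Function.update 1 e.1.1 1) e.1.2 1 with hy1
  set y2 : Config d := Function.update (Function.update 1 e.1.1 1) e.1.2 (-1) with hy2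
  set y3 : Config d := Function.update (Function.update 1 e.1.1 (-1)) e.1.2 1 with hy3
  set y4 : Config d := Function.update (Function.update 1 e.1.1 (-1)) e.1.2 (-1) with hy4
  have key : Δ ⬝ᵥ J y1 - Δ ⬝ᵥ J y2 - Δ ⬝ᵥ J y3 + Δ ⬝ᵥ J y4 = 4 * Δ e := by
    simp only [dotProduct, ← Finset.sum_sub_distrib, ← Finset.sum_add_distrib]
    have : ∀ e' : Pair d, Δ e' * J y1 e' - Δ e' * J y2 e' - Δ e' * J y3 e' + Δ e' * J y4 e' =
        if e' = e then 4 * Δ e else 0 := by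
      intro e'
      have h := mixed_difference_J e e'
      rw [← hy1, ← hy2, ← hy3, ← hy4] at h
      split_ifs at h ⊢ with h'
      · rw [h'] at h ⊢
        linear_combination Δ e * h
      · linear_combination Δ e' * h
    simp only [this, Finset.sum_ite_eq', Finset.mem_univ, if_true]
  have h1 := abs_lt.1 (hcon y1)
  have h2 := abs_lt.1 (hcon y2)
  have h3 := abs_lt.1 (hcon y3)
  have h4 := abs_lt.1 (hcon y4)
  rcases le_total 0 (Δ e) with h | h
  · rw [abs_of_nonneg h] at h1 h2 h3 h4
    linarith [h1.1, h1.2, h2.1, h2.2, h3.1, h3.2, h4.1, h4.2]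
  · rw [abs_of_nonpos h] at h1 h2 h3 h4
    linarith [h1.1, h1.2, h2.1, h2.2, h3.1, h3.2, h4.1, h4.2]

/-- The Fisher information is positive definite. -/
theorem exists_wvar_ge (θ : Param d) :
    ∃ c > 0, ∀ Δ : Param d, c * ‖Δ‖ ^ 2 ≤ wvar (isingWeight θ) fun y => Δ ⬝ᵥ J y := by
  obtain ⟨y0, -, hy0⟩ := Finset.exists_min_image Finset.univ (isingWeight θ) Finset.univ_nonempty
  refine ⟨isingWeight θ y0 / normConst θ, div_pos (isingWeight_pos _ _) (normConst_pos _),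
    fun Δ => ?_⟩
  set V := wvar (isingWeight θ) fun y => Δ ⬝ᵥ J y with hV
  have hV0 : 0 ≤ V := wvar_nonneg (fun y => (isingWeight_pos θ y).le) _
  have hc : 0 < isingWeight θ y0 / normConst θ := div_pos (isingWeight_pos _ _) (normConst_pos _)
  have he : ∀ e, |Δ e| ≤ √(V / (isingWeight θ y0 / normConst θ)) := by
    intro e
    obtain ⟨y, hy⟩ := exists_abs_sub_ge Δ e (wmean (isingWeight θ) fun y => Δ ⬝ᵥ J y)
    refine hy.trans (Real.abs_le_sqrt ?_)
    rw [le_div_iff₀ hc, hV, wvar, wmean, sum_isingWeight, mul_div_assoc']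
    refine div_le_div_of_nonneg_right ?_ (normConst_pos θ).le
    calc _ ≤ isingWeight θ y * (Δ ⬝ᵥ J y - wmean (isingWeight θ) fun y => Δ ⬝ᵥ J y) ^ 2 := by
          rw [mul_comm]
          exact mul_le_mul_of_nonneg_right (hy0 y (Finset.mem_univ _)) (sq_nonneg _)
      _ ≤ _ := Finset.single_le_sum (f := fun y => isingWeight θ y *
          (Δ ⬝ᵥ J y - wmean (isingWeight θ) fun y => Δ ⬝ᵥ J y) ^ 2)
          (fun y _ => mul_nonneg (isingWeight_pos θ y).le (sq_nonneg _)) (Finset.mem_univ y)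
  have hn : ‖Δ‖ ≤ _ := (pi_norm_le_iff_of_nonneg (Real.sqrt_nonneg _)).2 he
  have := pow_le_pow_left₀ (norm_nonneg _) hn 2
  rw [Real.sq_sqrt (div_nonneg hV0 hc.le), le_div_iff₀ hc] at this
  linarith

theorem l1On_pos_of_mem_cone {ξ : ℝ} {T : Finset (Pair d)} {θ : Param d} (h0 : θ ≠ 0)
    (h : θ ∈ cone ξ T) : 0 < l1On T θ := by
  refine lt_of_le_of_ne (l1On_nonneg _ _) fun hz => ?_
  have h1 : l1On Tᶜ θ ≤ ξ * l1On T θ := h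
  rw [← hz, mul_zero] at h1
  have h2 := norm_le_l1On θ
  rw [← l1On_add_compl T θ, ← hz, zero_add] at h2
  exact h0 (norm_le_zero_iff.1 (h2.trans h1))

/-- The cone invertibility factor of the Fisher information at `θ`. -/
theorem coneInvFactor_mul_le {ξ : ℝ} {T : Finset (Pair d)} (θ : Param d) {Δ : Param d}
    (h0 : Δ ≠ 0) (h : Δ ∈ cone ξ T) :
    coneInvFactor ξ T (hessian (fun θ => Real.log (normConst θ)) θ) * (l1On T Δ * ‖Δ‖) ≤
      wvar (isingWeight θ) fun y => Δ ⬝ᵥ J y := by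
  have hpos : 0 < l1On T Δ * ‖Δ‖ := mul_pos (l1On_pos_of_mem_cone h0 h) (norm_pos_iff.2 h0)
  rw [← le_div_iff₀ hpos, ← hessian_form]
  refine csInf_le ⟨0, ?_⟩ ⟨Δ, h0, h, rfl⟩
  rintro x ⟨Δ', -, -, rfl⟩
  rw [hessian_form]
  exact div_nonneg (wvar_nonneg (fun y => (isingWeight_pos θ y).le) _)
    (mul_nonneg (l1On_nonneg _ _) (norm_nonneg _))

theorem single_mem_cone {ξ : ℝ} (hξ : 0 ≤ ξ) {T : Finset (Pair d)} {e : Pair d} (he : e ∈ T) :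
    (Pi.single e 1 : Param d) ∈ cone ξ T := by
  have h1 : l1On Tᶜ (Pi.single e 1 : Param d) = 0 := by
    refine Finset.sum_eq_zero fun e' he' => ?_
    rw [Pi.single_eq_of_ne, abs_zero]
    rintro rfl
    exact Finset.mem_compl.1 he' he
  show l1On Tᶜ _ ≤ _
  rw [h1]
  exact mul_nonneg hξ (l1On_nonneg _ _)

/-- Positive definiteness bounds the form below by c|Δ|_∞², and |Δ_T|_1 ≤ |T||Δ|_∞ bounds the
denominator above. -/
theorem coneInvFactor_pos {ξ : ℝ} (hξ : 0 ≤ ξ) {T : Finset (Pair d)} (hT : T.Nonempty)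
    (θ : Param d) : 0 < coneInvFactor ξ T (hessian (fun θ => Real.log (normConst θ)) θ) := by
  obtain ⟨c, hc, hv⟩ := exists_wvar_ge θ
  obtain ⟨e, he⟩ := hT
  have hcard : (0 : ℝ) < T.card := by exact_mod_cast Finset.card_pos.2 ⟨e, he⟩
  refine lt_of_lt_of_le (div_pos hc hcard) (le_csInf
    ⟨_, Pi.single e 1, by simp, single_mem_cone hξ he, rfl⟩ ?_)
  rintro x ⟨Δ, h0, h, rfl⟩
  have hn := norm_pos_iff.2 h0
  rw [hessian_form, div_le_div_iff₀ hcard (mul_pos (l1On_pos_of_mem_cone h0 h) hn)]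
  calc c * (l1On T Δ * ‖Δ‖) ≤ c * (T.card * ‖Δ‖ * ‖Δ‖) := by
        have := l1On_le_card_mul T Δ
        gcongr
    _ = (c * ‖Δ‖ ^ 2) * T.card := by ring
    _ ≤ _ := mul_le_mul_of_nonneg_right (hv Δ) hcard.le

theorem wvar_single (θ : Param d) (e : Pair d) :
    (wvar (isingWeight θ) fun y => (Pi.single e 1 : Param d) ⬝ᵥ J y) =
      1 - (wmean (isingWeight θ) fun y => J y e) ^ 2 := by
  simp only [single_dotProduct_J]
  rw [wvar_eq (sum_isingWeight_ne_zero θ)]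
  simp only [pow_two, J_mul_self]
  rw [wmean_const (sum_isingWeight_ne_zero θ)]

/-- A coordinate vector from T has quotient equal to the variance of a ±1 variable. This serves the
case of small mβ₂. -/
theorem coneInvFactor_le_one {ξ : ℝ} (hξ : 0 ≤ ξ) {T : Finset (Pair d)} (hT : T.Nonempty)
    (θ : Param d) : coneInvFactor ξ T (hessian (fun θ => Real.log (normConst θ)) θ) ≤ 1 := by
  obtain ⟨e, he⟩ := hT
  have h := coneInvFactor_mul_le θ (Δ := Pi.single e 1) (by simp) (single_mem_cone hξ he)
  rw [wvar_single] at h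
  have h1 : l1On T (Pi.single e 1 : Param d) = 1 := by
    rw [l1On, Finset.sum_eq_single e]
    · simp
    · intro e' _ hne
      rw [Pi.single_eq_of_ne hne, abs_zero]
    · exact fun h => absurd he h
  have h2 : ‖(Pi.single e 1 : Param d)‖ = 1 := by
    rw [Pi.norm_single, norm_one]
  rw [h1, h2] at h
  nlinarith [sq_nonneg (wmean (isingWeight θ) fun y => J y e)]

/-- Strictness keeps 0 in the interior of the range used in `IsMarkovChain.numerator_deviation`. -/
theorem abs_mean_J_lt_one (θ : Param d) (e : Pair d) :
    |wmean (isingWeight θ) fun y => J y e| < 1 := by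
  obtain ⟨c, hc, hv⟩ := exists_wvar_ge θ
  have h := hv (Pi.single e 1)
  rw [wvar_single] at h
  have h2 : ‖(Pi.single e 1 : Param d)‖ = 1 := by
    rw [Pi.norm_single, norm_one]
  rw [h2] at h
  rw [← sq_lt_one_iff_abs_lt_one]
  linarith

end Fisher

/-! ### The penalized likelihood for a fixed realization of the samples -/

section Deterministic

variable {d n m : ℕ}

/-- The importance weights of the Monte Carlo sample at the parameter `θ`. -/
def impWeight (h : Config d → ℝ) (θ : Param d) (y : Config d) : ℝ := isingWeight θ y / h y

/-- The gradient of the approximation of the negative log-likelihood. -/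
def mcGrad (h : Config d → ℝ) (Y : Fin n → Config d) (X : Fin m → Config d) (θ : Param d) :
    Param d := fun e =>
  -((1 / (n : ℝ)) * ∑ i, J (Y i) e) + wmean (fun k => impWeight h θ (X k)) fun k => J (X k) e

variable {h : Config d → ℝ} (Y : Fin n → Config d) (X : Fin m → Config d)

theorem impWeight_pos (hh : ∀ y, 0 < h y) (θ : Param d) (y : Config d) : 0 < impWeight h θ y :=
  div_pos (isingWeight_pos _ _) (hh y)

/-- Moving along Δ only tilts the importance weights, so the one-variable log-sum-exp calculus
applies. -/
theorem mcLogLik_line [NeZero m] (hh : ∀ y, 0 < h y) (θ Δ : Param d) (t : ℝ) :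
    mcLogLik h Y X (θ + t • Δ) =
      (-((1 / (n : ℝ)) * ∑ i, θ ⬝ᵥ J (Y i)) + Real.log (1 / (m : ℝ))) +
        t * (-((1 / (n : ℝ)) * ∑ i, Δ ⬝ᵥ J (Y i))) +
        Real.log (∑ k, impWeight h θ (X k) * Real.exp (t * (Δ ⬝ᵥ J (X k)))) := by
  have h1 : ∀ k, Real.exp ((θ + t • Δ) ⬝ᵥ J (X k)) / h (X k) =
      impWeight h θ (X k) * Real.exp (t * (Δ ⬝ᵥ J (X k))) := by
    intro k
    have := isingWeight_add_smul θ Δ t (X k)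
    rw [isingWeight] at this
    rw [this, impWeight]; ring
  have hm : (1 / (m : ℝ)) ≠ 0 := by
    have : (m : ℝ) ≠ 0 := by exact_mod_cast NeZero.ne m
    positivity
  have hs := (sum_weight_pos fun k => mul_pos (impWeight_pos hh θ (X k))
    (Real.exp_pos (t * (Δ ⬝ᵥ J (X k))))).ne'
  rw [mcLogLik]
  simp only [h1]
  simp only [add_dotProduct, smul_dotProduct, smul_eq_mul, Finset.sum_add_distrib,
    ← Finset.mul_sum]
  rw [Real.log_mul hm hs]
  ring

theorem dotProduct_mcGrad (θ Δ : Param d) :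
    Δ ⬝ᵥ mcGrad h Y X θ = -((1 / (n : ℝ)) * ∑ i, Δ ⬝ᵥ J (Y i)) +
      wmean (fun k => impWeight h θ (X k)) fun k => Δ ⬝ᵥ J (X k) := by
  have h1 : (wmean (fun k => impWeight h θ (X k)) fun k => Δ ⬝ᵥ J (X k)) =
      ∑ e, Δ e * wmean (fun k => impWeight h θ (X k)) fun k => J (X k) e := by
    simp only [dotProduct]
    rw [wmean_sum]
    simp only [wmean_const_mul]
  rw [h1]
  simp only [dotProduct, mcGrad, mul_add, Finset.sum_add_distrib, mul_neg, Finset.sum_neg_distrib]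
  rw [Finset.sum_comm, Finset.mul_sum]
  congr 2
  refine Finset.sum_congr rfl fun e _ => ?_
  rw [← Finset.mul_sum]
  ring

theorem mcLogLik_add_ge [NeZero m] (hh : ∀ y, 0 < h y) (θ Δ : Param d) :
    mcLogLik h Y X θ + Δ ⬝ᵥ mcGrad h Y X θ ≤ mcLogLik h Y X (θ + Δ) := by
  have h0 := mcLogLik_line Y X hh θ Δ 0
  have h1 := mcLogLik_line Y X hh θ Δ 1
  have hj := wmean_le_log_sum_exp (fun k => impWeight_pos hh θ (X k)) fun k => Δ ⬝ᵥ J (X k)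
  simp only [zero_smul, add_zero, zero_mul, Real.exp_zero, mul_one] at h0
  simp only [one_smul, one_mul] at h1
  rw [h0, h1, dotProduct_mcGrad]
  linarith

theorem continuous_mcLogLik [NeZero m] (hh : ∀ y, 0 < h y) : Continuous (mcLogLik h Y X) := by
  have hm : (0 : ℝ) < 1 / (m : ℝ) := by
    have : 0 < m := Nat.pos_of_ne_zero (NeZero.ne m)
    positivity
  have hpos : ∀ θ : Param d, (1 / (m : ℝ)) * ∑ k, Real.exp (θ ⬝ᵥ J (X k)) / h (X k) ≠ 0 :=
    fun θ => (mul_pos hm (sum_weight_pos fun k => impWeight_pos hh θ (X k))).ne'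
  unfold mcLogLik
  refine Continuous.add ?_ (Continuous.log ?_ hpos)
  · unfold dotProduct
    fun_prop
  · refine continuous_const.mul (continuous_finsetSum _ fun k _ => ?_)
    unfold dotProduct
    fun_prop

/-- Convexity loses at most z|Δ|_1 while the penalty gains λ|Δ|_1 up to a constant; since z < λ, the
continuous objective is coercive. -/
theorem exists_isLassoMinimizer [NeZero m] (hh : ∀ y, 0 < h y) {θ : Param d} {lam z : ℝ}
    (hz : z < lam) (hgrad : ∀ e, |mcGrad h Y X θ e| ≤ z) :
    ∃ θ', IsLassoMinimizer h Y X lam θ' := by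
  have hcont : Continuous fun θ' => mcLogLik h Y X θ' + lam * l1On Finset.univ θ' :=
    (continuous_mcLogLik Y X hh).add (continuous_const.mul (continuous_l1On _))
  have hlow : ∀ Δ : Param d, mcLogLik h Y X θ - lam * l1On Finset.univ θ + (lam - z) * ‖Δ‖ ≤
      mcLogLik h Y X (θ + Δ) + lam * l1On Finset.univ (θ + Δ) := by
    intro Δ
    -- Without coordinates the gradient bound says nothing about the sign of λ.
    by_cases hΔ : IsEmpty (Pair d)
    · have h1 : Δ = 0 := Subsingleton.elim _ _
      have h2 : θ = 0 := Subsingleton.elim _ _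
      rw [h1, h2]
      simp [l1On]
    have hlam : 0 ≤ lam := by
      obtain ⟨e⟩ := not_isEmpty_iff.1 hΔ
      linarith [(abs_nonneg _).trans (hgrad e)]
    have h1 := mcLogLik_add_ge Y X hh θ Δ
    have h2 := neg_le_of_abs_le (abs_dotProduct_le (Δ := Δ) hgrad)
    have h3 : l1On Finset.univ Δ ≤ l1On Finset.univ (θ + Δ) + l1On Finset.univ θ := by
      simp only [l1On, ← Finset.sum_add_distrib]
      refine Finset.sum_le_sum fun e _ => ?_
      have := abs_sub (θ e + Δ e) (θ e)
      simpa using this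
    have h4 := mul_le_mul_of_nonneg_left (norm_le_l1On Δ) (by linarith : 0 ≤ lam - z)
    have h5 := mul_le_mul_of_nonneg_left h3 hlam
    linarith
  obtain ⟨x, hx⟩ := hcont.exists_forall_le (β := Param d) (by
    have hn : Filter.Tendsto (fun θ' : Param d =>
        mcLogLik h Y X θ - lam * l1On Finset.univ θ + (lam - z) * (‖θ'‖ - ‖θ‖))
        (Filter.cocompact _) Filter.atTop := by
      refine Filter.tendsto_atTop_add_const_left _ _ ?_
      refine Filter.Tendsto.const_mul_atTop (by linarith) ?_
      exact Filter.tendsto_atTop_add_const_right _ _ tendsto_norm_cocompact_atTop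
    refine Filter.tendsto_atTop_mono (fun θ' => ?_) hn
    have h1 := hlow (θ' - θ)
    rw [add_sub_cancel] at h1
    have h2 := mul_le_mul_of_nonneg_left (norm_sub_norm_le θ' θ) (by linarith : 0 ≤ lam - z)
    linarith)
  exact ⟨x, hx⟩

theorem deriv_nonpos_of_le {f : ℝ → ℝ} {f' : ℝ} (hf : HasDerivAt f f' 1)
    (hmin : ∀ t ∈ Set.Icc (0 : ℝ) 1, f 1 ≤ f t) : f' ≤ 0 := by
  have h1 := (hasDerivWithinAt_iff_tendsto_slope' (s := Set.Iio 1) (by simp)).1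
    (hf.hasDerivWithinAt)
  refine le_of_tendsto h1 ?_
  filter_upwards [Ioo_mem_nhdsLT (show (0 : ℝ) < 1 by norm_num)] with t ht
  rw [slope_def_field]
  have := hmin t ⟨ht.1.le, ht.2.le⟩
  exact div_nonpos_of_nonneg_of_nonpos (by linarith) (by linarith [ht.2])

/-- The optimality condition of a minimizer in the direction of another parameter. -/
theorem IsLassoMinimizer.deriv_le [NeZero m] (hh : ∀ y, 0 < h y) {θ Δ : Param d} {lam : ℝ}
    (hlam : 0 ≤ lam) (hmin : IsLassoMinimizer h Y X lam (θ + Δ)) :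
    -((1 / (n : ℝ)) * ∑ i, Δ ⬝ᵥ J (Y i)) +
      wmean (fun k => impWeight h θ (X k) * Real.exp (Δ ⬝ᵥ J (X k))) (fun k => Δ ⬝ᵥ J (X k)) ≤
      lam * (l1On Finset.univ θ - l1On Finset.univ (θ + Δ)) := by
  set c := (-((1 / (n : ℝ)) * ∑ i, θ ⬝ᵥ J (Y i)) + Real.log (1 / (m : ℝ))) with hc
  set b := (-((1 / (n : ℝ)) * ∑ i, Δ ⬝ᵥ J (Y i))) with hb
  -- The nonsmooth ℓ1 norm on the segment is replaced by its chord, which lies above it and agrees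
  -- at t = 1. The smooth majorant is thus also minimal at t = 1 on [0, 1], and its derivative there
  -- is nonpositive.
  have hd := ((((hasDerivAt_id (1 : ℝ)).mul_const b).const_add c).add
    (hasDerivAt_log_sum_exp (fun k => impWeight_pos hh θ (X k)) (fun k => Δ ⬝ᵥ J (X k)) 1)).add
    (((((hasDerivAt_id (1 : ℝ)).const_sub 1).mul_const (l1On Finset.univ θ)).add
      ((hasDerivAt_id (1 : ℝ)).mul_const (l1On Finset.univ (θ + Δ)))).const_mul lam)
  have hle := deriv_nonpos_of_le hd fun t ht => by
    have h1 := hmin (θ + t • Δ)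
    have e1 := mcLogLik_line Y X hh θ Δ 1
    rw [one_smul] at e1
    rw [e1, mcLogLik_line Y X hh θ Δ t] at h1
    have hconv : l1On Finset.univ (θ + t • Δ) ≤
        (1 - t) * l1On Finset.univ θ + t * l1On Finset.univ (θ + Δ) := by
      simp only [l1On, Finset.mul_sum, ← Finset.sum_add_distrib]
      refine Finset.sum_le_sum fun e _ => ?_
      have : (θ + t • Δ) e = (1 - t) * θ e + t * (θ + Δ) e := by
        simp only [Pi.add_apply, Pi.smul_apply, smul_eq_mul]; ring
      rw [this]
      refine (abs_add_le _ _).trans ?_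
      rw [abs_mul, abs_mul, abs_of_nonneg ht.1, abs_of_nonneg (by linarith [ht.2] : 0 ≤ 1 - t)]
    have := mul_le_mul_of_nonneg_left hconv hlam
    simp only [Pi.add_apply, id]
    linarith
  simp only [one_mul] at hle
  linarith

/-- The inequalities are used twice. Multiplied by 2s, they force 1 - e^{-2s} ≤ e^{-1}, so s is
small; the Bregman factor is then at least e^{-1}, and x ≤ s yields the bound on D. Here `Fh` is the
factor F(α-2)/α of the observed information. -/
theorem l1On_bound_arith {x s D d₀ Fh lam ξ B V : ℝ} (hξ : 1 < ξ) (hx : 0 < x) (hs : 0 < s)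
    (hD : 0 < D) (hlam : 0 < lam) (hF : 0 < Fh) (hxs : x ≤ s)
    (hxd : x ≤ d₀ * D)
    (hlow : (1 - Real.exp (-(2 * s))) / (2 * s) * V ≤ B) (hV : Fh * (x * D) ≤ V)
    (hup : B ≤ 2 * lam / (ξ + 1) * ((ξ + 1) * x - s))
    (hsmall : lam * (ξ + 1) * d₀ ≤ Fh * Real.exp (-1)) :
    D ≤ 2 * Real.exp 1 * ξ * lam / ((ξ + 1) * Fh) := by
  have hE : 0 < 1 - Real.exp (-(2 * s)) := by
    have : Real.exp (-(2 * s)) < 1 := by rw [Real.exp_lt_one_iff]; linarith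
    linarith
  have hfac : 0 < (1 - Real.exp (-(2 * s))) / (2 * s) := by positivity
  have h1 : (1 - Real.exp (-(2 * s))) / (2 * s) * (Fh * (x * D)) ≤
      2 * lam / (ξ + 1) * ((ξ + 1) * x - s) :=
    ((mul_le_mul_of_nonneg_left hV hfac.le).trans hlow).trans hup
  have h2 : (1 - Real.exp (-(2 * s))) * (Fh * (x * D)) ≤ lam * (ξ + 1) * x ^ 2 := by
    have h3 := mul_le_mul_of_nonneg_left h1 (by positivity : 0 ≤ 2 * s)
    have e1 : 2 * s * ((1 - Real.exp (-(2 * s))) / (2 * s) * (Fh * (x * D))) =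
        (1 - Real.exp (-(2 * s))) * (Fh * (x * D)) := by field_simp
    have e2 : 2 * s * (2 * lam / (ξ + 1) * ((ξ + 1) * x - s)) =
        lam / (ξ + 1) * (4 * s * ((ξ + 1) * x - s)) := by ring
    rw [e1, e2] at h3
    refine h3.trans ?_
    -- Maximizing over s removes the unknown ℓ1 norm.
    have h4 : 4 * s * ((ξ + 1) * x - s) ≤ ((ξ + 1) * x) ^ 2 := by
      nlinarith [sq_nonneg ((ξ + 1) * x - 2 * s)]
    calc _ ≤ lam / (ξ + 1) * ((ξ + 1) * x) ^ 2 := by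
          refine mul_le_mul_of_nonneg_left h4 ?_
          have : 0 < ξ + 1 := by linarith
          positivity
      _ = _ := by
          have : ξ + 1 ≠ 0 := by linarith
          field_simp
  have h3 : (1 - Real.exp (-(2 * s))) * (Fh * (x * D)) ≤ Real.exp (-1) * (Fh * (x * D)) := by
    refine h2.trans ?_
    calc lam * (ξ + 1) * x ^ 2 = lam * (ξ + 1) * x * x := by ring
      _ ≤ lam * (ξ + 1) * x * (d₀ * D) := by
          refine mul_le_mul_of_nonneg_left hxd ?_
          have : 0 < ξ + 1 := by linarith
          positivity
      _ = lam * (ξ + 1) * d₀ * (x * D) := by ring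
      _ ≤ Fh * Real.exp (-1) * (x * D) := mul_le_mul_of_nonneg_right hsmall (by positivity)
      _ = _ := by ring
  have h4 : 1 - Real.exp (-(2 * s)) ≤ Real.exp (-1) := le_of_mul_le_mul_right h3 (by positivity)
  have h5 : Real.exp (-1) ≤ 1 / 2 := by
    rw [Real.exp_neg, inv_le_comm₀ (Real.exp_pos _) (by norm_num)]
    have := Real.add_one_le_exp (1 : ℝ)
    linarith
  -- Uses e^{-1} ≤ 1 - e^{-1}, that is, e ≥ 2.
  have h6 : Real.exp (-1) ≤ Real.exp (-(2 * s)) := by linarith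
  have h7 : Real.exp (-(2 * s)) ≤ (1 - Real.exp (-(2 * s))) / (2 * s) := by
    rw [le_div_iff₀ (by positivity)]
    have h8 := Real.add_one_le_exp (2 * s)
    have h9 : Real.exp (-(2 * s)) * Real.exp (2 * s) = 1 := by rw [← Real.exp_add]; simp
    nlinarith [Real.exp_pos (-(2 * s))]
  have h8 : Real.exp (-1) * (Fh * (x * D)) ≤ 2 * lam / (ξ + 1) * (ξ * x) := by
    have := mul_le_mul_of_nonneg_right (h6.trans h7) (by positivity : 0 ≤ Fh * (x * D))
    refine this.trans (h1.trans ?_)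
    have hc : (ξ + 1) * x - s ≤ ξ * x := by linarith
    have : 0 < ξ + 1 := by linarith
    exact mul_le_mul_of_nonneg_left hc (by positivity)
  have hξ1 : 0 < ξ + 1 := by linarith
  rw [le_div_iff₀ (by positivity)]
  have h9 : Real.exp 1 * Real.exp (-1) = 1 := by rw [← Real.exp_add]; simp
  have h10 : Fh * D * x ≤ Real.exp 1 * (2 * lam / (ξ + 1) * ξ) * x := by
    have := mul_le_mul_of_nonneg_left h8 (Real.exp_pos 1).le
    rw [← mul_assoc, h9] at this
    linarith
  have h11 := le_of_mul_le_mul_right h10 hx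
  have h12 := mul_le_mul_of_nonneg_left h11 hξ1.le
  have e : (ξ + 1) * (Real.exp 1 * (2 * lam / (ξ + 1) * ξ)) = 2 * Real.exp 1 * ξ * lam := by
    field_simp
  rw [e] at h12
  linarith

theorem coneInvFactor_nonneg {ξ : ℝ} {T : Finset (Pair d)} (θ : Param d) :
    0 ≤ coneInvFactor ξ T (hessian (fun θ => Real.log (normConst θ)) θ) := by
  refine Real.sInf_nonneg ?_
  rintro x ⟨Δ, -, -, rfl⟩
  rw [hessian_form]
  exact div_nonneg (wvar_nonneg (fun y => (isingWeight_pos θ y).le) _)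
    (mul_nonneg (l1On_nonneg _ _) (norm_nonneg _))

theorem wvar_impWeight_ge [NeZero m] (hh : ∀ y, 0 < h y) {θ Δ : Param d} {δ : ℝ}
    (hcov : ∀ e e', |wcov (fun k => impWeight h θ (X k)) (fun k => J (X k)) e e' -
      wcov (isingWeight θ) J e e'| ≤ δ) :
    (wvar (isingWeight θ) fun y => Δ ⬝ᵥ J y) - δ * l1On Finset.univ Δ ^ 2 ≤
      wvar (fun k => impWeight h θ (X k)) fun k => Δ ⬝ᵥ J (X k) := by
  rw [wvar_dotProduct (sum_isingWeight_ne_zero θ),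
    wvar_dotProduct (sum_weight_pos fun k => impWeight_pos hh θ (X k)).ne' fun k => J (X k)]
  rw [sub_le_comm, ← Finset.sum_sub_distrib, pow_two, l1On, Finset.sum_mul_sum, Finset.mul_sum]
  refine Finset.sum_le_sum fun e _ => ?_
  rw [← Finset.sum_sub_distrib, Finset.mul_sum]
  refine Finset.sum_le_sum fun e' _ => ?_
  rw [← mul_sub, ← abs_mul]
  refine (le_abs_self _).trans ?_
  rw [abs_mul, abs_sub_comm, mul_comm]
  exact mul_le_mul_of_nonneg_right (hcov e e') (abs_nonneg _)

/-- The oracle inequality on the event where the gradient is dominated by the smoothing parameter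
and the observed information is close to the Fisher information. -/
theorem IsLassoMinimizer.norm_sub_le [NeZero m] (hh : ∀ y, 0 < h y) {θs θ : Param d}
    {ξ lam δ F : ℝ} (hξ : 1 < ξ) (hlam : 0 < lam)
    (hF : F = coneInvFactor ξ (supp θs) (hessian (fun θ => Real.log (normConst θ)) θs))
    (hgrad : ∀ e, |mcGrad h Y X θs e| ≤ (ξ - 1) / (ξ + 1) * lam)
    (hcov : (supp θs).Nonempty → ∀ e e',
      |wcov (fun k => impWeight h θs (X k)) (fun k => J (X k)) e e' -
        wcov (isingWeight θs) J e e'| ≤ δ)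
    (hδ : (supp θs).Nonempty → δ * (1 + ξ) ^ 2 * (supp θs).card ≤ 2 * F / alpha ξ)
    (hsmall : (supp θs).Nonempty →
      lam * (ξ + 1) * (supp θs).card ≤ F * (alpha ξ - 2) / alpha ξ * Real.exp (-1))
    (hmin : IsLassoMinimizer h Y X lam θ) :
    ‖θ - θs‖ ≤ 2 * Real.exp 1 * ξ * alpha ξ * lam / ((ξ + 1) * (alpha ξ - 2) * F) := by
  have hξ1 : 0 < ξ - 1 := by linarith
  have hα : 0 < alpha ξ - 2 := by
    rw [alpha, add_sub_cancel_left]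
    exact div_pos (Real.exp_pos _) hξ1
  have hα0 : 0 < alpha ξ := by linarith
  have hF0 : 0 ≤ F := hF ▸ coneInvFactor_nonneg θs
  obtain ⟨Δ, rfl⟩ : ∃ Δ, θ = θs + Δ := ⟨θ - θs, by simp⟩
  rw [add_sub_cancel_left]
  by_cases hΔ0 : Δ = 0
  · rw [hΔ0, norm_zero]
    positivity
  set T := supp θs with hT
  set W := fun k => impWeight h θs (X k) with hW
  set a := fun k => Δ ⬝ᵥ J (X k) with ha
  have hWpos : ∀ k, 0 < W k := fun k => impWeight_pos hh θs (X k)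
  set s := l1On Finset.univ Δ with hs
  set x := l1On T Δ with hx
  set B := wmean (fun k => W k * Real.exp (a k)) a - wmean W a with hB
  have hcompl := l1On_add_compl T Δ
  have hs0 : 0 < s := lt_of_lt_of_le (norm_pos_iff.2 hΔ0) (norm_le_l1On Δ)
  have hup : B ≤ 2 * lam / (ξ + 1) * ((ξ + 1) * x - s) := by
    have h1 := hmin.deriv_le Y X hh hlam.le
    have h2 := dotProduct_mcGrad (h := h) Y X θs Δ
    have h3 := neg_le_of_abs_le (abs_dotProduct_le (Δ := Δ) hgrad)
    have h4 := mul_le_mul_of_nonneg_left (l1On_sub_le θs Δ) hlam.le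
    have h5 : lam * (x - l1On Tᶜ Δ) + (ξ - 1) / (ξ + 1) * lam * s =
        2 * lam / (ξ + 1) * ((ξ + 1) * x - s) := by
      have : l1On Tᶜ Δ = s - x := by linarith
      rw [this]
      have : ξ + 1 ≠ 0 := by linarith
      field_simp
      ring
    rw [← h5]
    linarith
  have hη : ∀ k l, a k - a l ≤ 2 * s := fun k l => dotProduct_J_sub_le Δ (X k) (X l)
  have hlow := bregman_ge hWpos (by linarith : 0 < 2 * s) hη
  have hB0 : 0 ≤ B := by
    refine le_trans (mul_nonneg (div_nonneg ?_ (by linarith))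
      (wvar_nonneg (fun k => (hWpos k).le) a)) hlow
    have : Real.exp (-(2 * s)) ≤ 1 := Real.exp_le_one_iff.2 (by linarith)
    linarith
  -- Nonnegativity of the Bregman divergence is the cone condition.
  have hcone' : s ≤ (ξ + 1) * x := by
    have : 0 ≤ 2 * lam / (ξ + 1) * ((ξ + 1) * x - s) := hB0.trans hup
    have hpos : 0 < 2 * lam / (ξ + 1) := div_pos (by linarith) (by linarith)
    have := nonneg_of_mul_nonneg_right this hpos
    linarith
  have hcone : Δ ∈ cone ξ T := by
    show l1On Tᶜ Δ ≤ ξ * l1On T Δ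
    linarith
  have hx0 : 0 < x := l1On_pos_of_mem_cone hΔ0 hcone
  -- For empty T a nonzero Δ is impossible, so the case Δ = 0 already covers the convention that
  -- division by F = 0 gives 0.
  have hTne : T.Nonempty := by
    rw [Finset.nonempty_iff_ne_empty]
    intro h0
    rw [hx, h0] at hx0
    simp [l1On] at hx0
  have hFpos : 0 < F := hF ▸ coneInvFactor_pos (by linarith) hTne θs
  have hD0 : 0 < ‖Δ‖ := norm_pos_iff.2 hΔ0
  have hxd := l1On_le_card_mul T Δ
  have hV : F * (alpha ξ - 2) / alpha ξ * (x * ‖Δ‖) ≤ wvar W a := by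
    refine le_trans ?_ (wvar_impWeight_ge X hh (hcov hTne))
    have h1 := coneInvFactor_mul_le θs hΔ0 hcone
    rw [← hF] at h1
    have hδ0 : 0 ≤ δ := by
      obtain ⟨e, -⟩ := id hTne
      exact (abs_nonneg _).trans (hcov hTne e e)
    -- On the cone, s² ≤ (1+ξ)²|T|·x|Δ|_∞, so replacing the Fisher information by the observed one
    -- costs the fraction 2/α of F.
    have h2 : δ * s ^ 2 ≤ 2 * F / alpha ξ * (x * ‖Δ‖) := by
      calc δ * s ^ 2 ≤ δ * ((ξ + 1) * x) ^ 2 := by gcongr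
        _ = δ * (1 + ξ) ^ 2 * x * x := by ring
        _ ≤ δ * (1 + ξ) ^ 2 * x * (T.card * ‖Δ‖) := by gcongr
        _ = δ * (1 + ξ) ^ 2 * T.card * (x * ‖Δ‖) := by ring
        _ ≤ _ := mul_le_mul_of_nonneg_right (hδ hTne) (by positivity)
    have e : F * (alpha ξ - 2) / alpha ξ * (x * ‖Δ‖) =
        F * (x * ‖Δ‖) - 2 * F / alpha ξ * (x * ‖Δ‖) := by
      field_simp
    rw [e]
    linarith
  have hfin := l1On_bound_arith hξ hx0 hs0 hD0 hlam
    (div_pos (mul_pos hFpos hα) hα0) (by linarith [l1On_nonneg Tᶜ Δ]) hxd hlow hV hup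
    (hsmall hTne)
  refine hfin.trans (le_of_eq ?_)
  have : ξ + 1 ≠ 0 := by linarith
  field_simp

end Deterministic

/-! ### Deviation bounds for the two samples -/

section Probability

variable {Ω : Type*} [MeasurableSpace Ω] {P : Measure Ω} {d n m : ℕ}

theorem IsMarkovChain.path_law [IsProbabilityMeasure P] {k : ℕ} {q : Config d → ℝ}
    {K : Matrix (Config d) (Config d) ℝ} {X : Fin (k + 1) → Ω → Config d}
    (hX : IsMarkovChain P q K X) (x : Fin (k + 1) → Config d) :
    P.real {ω | ∀ j, X j ω = x j} = pathWeight q K x := by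
  have key : ∀ (i : ℕ) (hi : i < k + 1),
      P.real {ω | ∀ j : Fin (k + 1), j.val ≤ i → X j ω = x j} = q (x 0) * ∏ l : Fin i,
        K (x ⟨l.val, l.isLt.trans hi⟩) (x ⟨l.val + 1, (Nat.succ_le_of_lt l.isLt).trans_lt hi⟩) := by
    intro i
    induction i with
    | zero =>
      intro hi
      rw [Fin.prod_univ_zero, mul_one, ← hX.init (Nat.succ_pos k)]
      congr 1
      ext ω
      constructor
      · exact fun h => h 0 le_rfl
      · intro h j hj
        have : j = 0 := Fin.ext (Nat.le_zero.1 hj)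
        rw [this]
        exact h
    | succ i ih =>
      intro hi
      rw [hX.step i hi x, ih (Nat.lt_of_succ_lt hi), Fin.prod_univ_castSucc, mul_assoc]
      rfl
  have h := key k (Nat.lt_succ_self k)
  rw [pathWeight]
  have hset : {ω | ∀ j, X j ω = x j} = {ω | ∀ j : Fin (k + 1), j.val ≤ k → X j ω = x j} := by
    ext ω
    constructor
    · exact fun h j _ => h j
    · exact fun h j => h j (Nat.le_of_lt_succ j.isLt)
  rw [hset, h]
  rfl

theorem IsMarkovChain.one_le_sum [IsProbabilityMeasure P] {q : Config d → ℝ}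
    {K : Matrix (Config d) (Config d) ℝ} {X : Fin m → Ω → Config d}
    (hX : IsMarkovChain P q K X) (hm : 0 < m) : 1 ≤ ∑ y, q y := by
  have h1 : (Set.univ : Set Ω) ⊆ ⋃ y : Config d, {ω | X ⟨0, hm⟩ ω = y} := fun ω _ =>
    Set.mem_iUnion.2 ⟨X ⟨0, hm⟩ ω, rfl⟩
  calc (1 : ℝ) = P.real Set.univ := by simp
    _ ≤ P.real (⋃ y : Config d, {ω | X ⟨0, hm⟩ ω = y}) := measureReal_mono h1
    _ ≤ ∑ y, P.real {ω | X ⟨0, hm⟩ ω = y} := measureReal_iUnion_fintype_le _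
    _ = ∑ y, q y := Finset.sum_congr rfl fun y _ => hX.init hm y

theorem one_le_beta1 {q h : Config d → ℝ} (hh : ∀ y, 0 < h y) (hh1 : ∑ y, h y = 1)
    (hq : 1 ≤ ∑ y, q y) : 1 ≤ beta1 q h := by
  refine Real.le_sqrt_of_sq_le ?_
  have cs : (∑ y, q y) ^ 2 ≤ (∑ y, q y ^ 2 / h y) * ∑ y, h y :=
    Finset.sum_sq_le_sum_mul_sum_of_sq_le_mul _ (fun y _ => div_nonneg (sq_nonneg _) (hh y).le)
      (fun y _ => (hh y).le) fun y _ => le_of_eq (by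
        have := (hh y).ne'
        field_simp)
  rw [hh1, mul_one] at cs
  nlinarith

/-- Hoeffding bound for the Gibbs sampler. -/
theorem IsMarkovChain.tail_le [IsProbabilityMeasure P] (hd : 0 < d) (hm : 0 < m) {ψ : Param d}
    {q : Config d → ℝ} {X : Fin m → Ω → Config d} (hX : IsMarkovChain P q (gibbsKernel ψ) X)
    {f : Config d → ℝ} {a b t : ℝ} (ha : a < 0) (hb : 0 < b) (hf : ∀ y, f y ∈ Set.Icc a b)
    (hf0 : ∑ y, isingDensity ψ y * f y = 0) (ht : 0 < t) :
    P.real {ω | m * t ≤ ∑ k, f (X k ω)} ≤ beta1 q (isingDensity ψ) *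
      Real.exp (-(m * beta2 (gibbsKernel ψ) * t ^ 2 / (b - a) ^ 2)) := by
  obtain ⟨k, rfl⟩ := Nat.exists_eq_succ_of_ne_zero hm.ne'
  classical
  set A : Finset (Fin (k + 1) → Config d) :=
    Finset.univ.filter fun x => ((k + 1 : ℕ) : ℝ) * t ≤ ∑ i, f (x i) with hA
  have h1 : {ω | ((k + 1 : ℕ) : ℝ) * t ≤ ∑ i, f (X i ω)} ⊆
      ⋃ x ∈ A, {ω | ∀ j, X j ω = x j} := by
    intro ω hω
    simp only [Set.mem_iUnion]
    exact ⟨fun i => X i ω, by rw [hA, Finset.mem_filter]; exact ⟨Finset.mem_univ _, hω⟩,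
      fun j => rfl⟩
  calc P.real {ω | ((k + 1 : ℕ) : ℝ) * t ≤ ∑ i, f (X i ω)}
      ≤ P.real (⋃ x ∈ A, {ω | ∀ j, X j ω = x j}) := measureReal_mono h1 (measure_ne_top P _)
    _ ≤ ∑ x ∈ A, P.real {ω | ∀ j, X j ω = x j} := measureReal_biUnion_finset_le _ _
    _ = ∑ x ∈ A, pathWeight q (gibbsKernel ψ) x :=
        Finset.sum_congr rfl fun x _ => hX.path_law x
    _ ≤ _ := by
        have := (isReversibleGap_gibbsKernel hd ψ).tail_le (q := q) ha hb hf hf0 ht k A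
          fun x hx => by
            have := (Finset.mem_filter.1 hx).2
            push_cast at this
            exact this
        rw [beta1, beta2]
        push_cast
        exact this

/-- The σ-algebra on the units is pulled back from ℤ along the injective coercion. -/
instance : MeasurableSingletonClass ℤˣ :=
  ⟨fun u => by
    have : ({u} : Set ℤˣ) = (fun v : ℤˣ => (v : ℤ)) ⁻¹' {(u : ℤ)} := by
      ext v
      simp [Units.ext_iff]
    rw [this]
    exact comap_measurable Units.val (measurableSet_singleton _)⟩

theorem IsIsingSample.integral_eq [IsProbabilityMeasure P] {θ : Param d}
    {Y : Fin n → Ω → Config d} (hY : IsIsingSample P θ Y) (f : Config d → ℝ) (i : Fin n) :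
    ∫ ω, f (Y i ω) ∂P = wmean (isingWeight θ) f := by
  have hm := hY.measurable i
  have := Measure.isProbabilityMeasure_map (μ := P) hm.aemeasurable
  have h1 : ∫ ω, f (Y i ω) ∂P = ∫ y, f y ∂(P.map (Y i)) :=
    (integral_map hm.aemeasurable (measurable_of_finite f).aestronglyMeasurable).symm
  rw [h1, integral_fintype .of_finite, wmean, sum_isingWeight, Finset.sum_div]
  refine Finset.sum_congr rfl fun y _ => ?_
  rw [map_measureReal_apply hm (measurableSet_singleton y), smul_eq_mul]
  have := hY.law i y
  rw [show Y i ⁻¹' {y} = {ω | Y i ω = y} from rfl, this, isingDensity, isingWeight]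
  ring

/-- Hoeffding bound for the observed sample. -/
theorem IsIsingSample.tail_le [IsProbabilityMeasure P] {θ : Param d}
    {Y : Fin n → Ω → Config d} (hY : IsIsingSample P θ Y) {f : Config d → ℝ}
    (hf : ∀ y, |f y| ≤ 1) {t : ℝ} (ht : 0 ≤ t) :
    P.real {ω | n * t ≤ ∑ i, (f (Y i ω) - wmean (isingWeight θ) f)} ≤
      Real.exp (-(n * t ^ 2 / 2)) := by
  have hsub : ∀ i ∈ Finset.univ, HasSubgaussianMGF
      (fun ω => f (Y i ω) - wmean (isingWeight θ) f) 1 P := by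
    intro i _
    have h := hasSubgaussianMGF_of_mem_Icc (μ := P) (X := fun ω => f (Y i ω)) (a := -1) (b := 1)
      ((measurable_of_finite f).comp (hY.measurable i)).aemeasurable
      (Filter.Eventually.of_forall fun ω => abs_le.1 (hf _))
    rw [hY.integral_eq f i] at h
    convert h using 1
    ext
    norm_num
  have hind : iIndepFun (fun i ω => f (Y i ω) - wmean (isingWeight θ) f) P :=
    hY.indep.comp (fun _ y => f y - wmean (isingWeight θ) f) fun _ => measurable_of_finite _
  have h := HasSubgaussianMGF.measure_sum_ge_le_of_iIndepFun hind hsub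
    (mul_nonneg (Nat.cast_nonneg n) ht)
  refine h.trans (Real.exp_le_exp.2 (le_of_eq ?_))
  simp only [Finset.sum_const, Finset.card_univ, Fintype.card_fin, nsmul_eq_mul, mul_one,
    NNReal.coe_natCast]
  rcases Nat.eq_zero_or_pos n with rfl | hn
  · simp
  · have : (n : ℝ) ≠ 0 := by positivity
    field_simp

theorem card_pair (d : ℕ) : (Fintype.card (Pair d) : ℝ) = numParam d := by
  have h1 : Fintype.card (Pair d) = ∑ b : Fin d, b.val := by
    rw [Fintype.card_subtype, Finset.card_filter, Fintype.sum_prod_type_right]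
    refine Finset.sum_congr rfl fun b _ => ?_
    rw [← Finset.card_filter]
    have : Finset.univ.filter (fun a : Fin d => a < b) = Finset.Iio b := by ext; simp
    rw [this, Fin.card_Iio]
  have h2 := Finset.sum_range_id_mul_two d
  rw [Finset.sum_range] at h2
  rw [h1, numParam]
  rcases d with _ | d
  · simp
  · have h3 : ((∑ b : Fin (d + 1), b.val : ℕ) : ℝ) * 2 = ((d + 1 : ℕ) : ℝ) * (d : ℝ) := by
      exact_mod_cast h2
    push_cast at h3 ⊢
    linarith

end Probability

/-! ### The importance sampling weights -/

section Importance

variable {d m : ℕ}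

/-- The density ratio of the two Ising models. -/
def densityRatio (θ ψ : Param d) (y : Config d) : ℝ := isingDensity θ y / isingDensity ψ y

variable (θ ψ : Param d)

theorem densityRatio_pos (y : Config d) : 0 < densityRatio θ ψ y :=
  div_pos (isingDensity_pos _ _) (isingDensity_pos _ _)

theorem densityRatio_le (y : Config d) : densityRatio θ ψ y ≤ ratioMax θ (isingDensity ψ) := by
  have := le_ciSup (f := fun y : Config d =>
    Real.exp (θ ⬝ᵥ J y) / (isingDensity ψ y * normConst θ)) (Set.finite_range _).bddAbove y
  refine le_trans (le_of_eq ?_) this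
  rw [densityRatio, isingDensity, div_div, mul_comm]

theorem isingDensity_mul_densityRatio (y : Config d) :
    isingDensity ψ y * densityRatio θ ψ y = isingDensity θ y := by
  rw [densityRatio, mul_div_cancel₀ _ (isingDensity_pos ψ y).ne']

theorem one_le_ratioMax : 1 ≤ ratioMax θ (isingDensity ψ) := by
  have h1 : ∑ y, isingDensity ψ y * densityRatio θ ψ y ≤
      ∑ y, isingDensity ψ y * ratioMax θ (isingDensity ψ) :=
    Finset.sum_le_sum fun y _ =>
      mul_le_mul_of_nonneg_left (densityRatio_le θ ψ y) (isingDensity_pos ψ y).le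
  rw [← Finset.sum_mul, sum_isingDensity, one_mul] at h1
  simpa only [isingDensity_mul_densityRatio, sum_isingDensity] using h1

theorem sum_density_mul_one_sub_ratio :
    ∑ y, isingDensity ψ y * (1 - densityRatio θ ψ y) = 0 := by
  simp only [mul_sub, isingDensity_mul_densityRatio, Finset.sum_sub_distrib, mul_one,
    sum_isingDensity, sub_self]

theorem wmean_isingWeight (f : Config d → ℝ) :
    wmean (isingWeight θ) f = ∑ y, isingDensity θ y * f y := by
  rw [wmean, sum_isingWeight, Finset.sum_div]
  refine Finset.sum_congr rfl fun y _ => ?_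
  rw [isingDensity, isingWeight]; ring

theorem sum_density_mul_ratio_mul_centered (f : Config d → ℝ) :
    ∑ y, isingDensity ψ y * (densityRatio θ ψ y * (f y - wmean (isingWeight θ) f)) = 0 := by
  simp only [← mul_assoc, isingDensity_mul_densityRatio, mul_sub, Finset.sum_sub_distrib,
    ← Finset.sum_mul, sum_isingDensity, ← wmean_isingWeight, one_mul, sub_self]

theorem impWeight_eq (y : Config d) :
    impWeight (isingDensity ψ) θ y = normConst θ * densityRatio θ ψ y := by
  have := (normConst_pos θ).ne'
  have := (isingDensity_pos ψ y).ne'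
  rw [impWeight, densityRatio, isingDensity.eq_def θ, isingWeight]
  field_simp

/-- Self-normalized importance sampling: error of the mean in terms of the numerator. -/
theorem abs_wmean_impWeight_sub_le [NeZero m] {X : Fin m → Config d} {f : Config d → ℝ} {t : ℝ}
    (hden : (m : ℝ) * (1 / 2) ≤ ∑ k, densityRatio θ ψ (X k))
    (hnum : |∑ k, densityRatio θ ψ (X k) * (f (X k) - wmean (isingWeight θ) f)| ≤ m * t) :
    |(wmean (fun k => impWeight (isingDensity ψ) θ (X k)) fun k => f (X k)) -
      wmean (isingWeight θ) f| ≤ 2 * t := by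
  set μ := wmean (isingWeight θ) f with hμ
  have hC := (normConst_pos θ).ne'
  have hm : (0 : ℝ) < m := by exact_mod_cast Nat.pos_of_ne_zero (NeZero.ne m)
  have hS : 0 < ∑ k, densityRatio θ ψ (X k) := lt_of_lt_of_le (by positivity) hden
  have e : (wmean (fun k => impWeight (isingDensity ψ) θ (X k)) fun k => f (X k)) - μ =
      (∑ k, densityRatio θ ψ (X k) * (f (X k) - μ)) / ∑ k, densityRatio θ ψ (X k) := by
    simp only [wmean, impWeight_eq, mul_assoc, ← Finset.mul_sum]
    rw [mul_div_mul_left _ _ hC]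
    simp only [mul_sub, Finset.sum_sub_distrib, ← Finset.sum_mul]
    field_simp
  rw [e, abs_div, abs_of_pos hS, div_le_iff₀ hS]
  have ht : 0 ≤ t := by
    have := (abs_nonneg _).trans hnum
    exact nonneg_of_mul_nonneg_right this hm
  refine hnum.trans ?_
  have := mul_le_mul_of_nonneg_left hden (by linarith : 0 ≤ 2 * t)
  linarith

end Importance

/-! ### Deviation events for the two samples -/

section Events

variable {Ω : Type*} [MeasurableSpace Ω] {P : Measure Ω} {d n m : ℕ}

theorem measureReal_exists_le {E : Type*} [Fintype E] (p : E → Ω → Prop) {c : ℝ}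
    (h : ∀ e, P.real {ω | p e ω} ≤ c) : P.real {ω | ∃ e, p e ω} ≤ Fintype.card E * c := by
  have h1 : {ω | ∃ e, p e ω} = ⋃ e, {ω | p e ω} := by ext; simp
  rw [h1]
  refine (measureReal_iUnion_fintype_le _).trans ?_
  simpa using Finset.sum_le_sum fun e (_ : e ∈ Finset.univ) => h e

variable [IsProbabilityMeasure P]

theorem measureReal_le_add_of_imp {p q r : Ω → Prop} (h : ∀ ω, p ω → q ω ∨ r ω) :
    P.real {ω | p ω} ≤ P.real {ω | q ω} + P.real {ω | r ω} :=
  (measureReal_mono fun ω hω => h ω hω).trans (measureReal_union_le _ _)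

theorem IsMarkovChain.abs_tail_le (hd : 0 < d) (hm : 0 < m) {ψ : Param d}
    {q : Config d → ℝ} {X : Fin m → Ω → Config d} (hX : IsMarkovChain P q (gibbsKernel ψ) X)
    {f : Config d → ℝ} {a b t : ℝ} (ha : a < 0) (hb : 0 < b) (hf : ∀ y, f y ∈ Set.Icc a b)
    (hf0 : ∑ y, isingDensity ψ y * f y = 0) (ht : 0 < t) :
    P.real {ω | m * t ≤ |∑ k, f (X k ω)|} ≤ 2 * (beta1 q (isingDensity ψ) *
      Real.exp (-(m * beta2 (gibbsKernel ψ) * t ^ 2 / (b - a) ^ 2))) := by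
  have h1 := hX.tail_le hd hm ha hb hf hf0 ht
  have h2 := hX.tail_le hd hm (f := fun y => -f y) (a := -b) (b := -a) (by linarith) (by linarith)
    (fun y => ⟨neg_le_neg (hf y).2, neg_le_neg (hf y).1⟩) (by simp [hf0]) ht
  have h3 := measureReal_le_add_of_imp (P := P) (p := fun ω => m * t ≤ |∑ k, f (X k ω)|)
    (q := fun ω => m * t ≤ ∑ k, f (X k ω)) (r := fun ω => m * t ≤ ∑ k, -f (X k ω)) fun ω hω => by
      rw [Finset.sum_neg_distrib]
      exact le_abs.1 hω
  rw [show -a - -b = b - a by ring] at h2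
  linarith

theorem IsIsingSample.abs_tail_le {θ : Param d} {Y : Fin n → Ω → Config d}
    (hY : IsIsingSample P θ Y) {f : Config d → ℝ} (hf : ∀ y, |f y| ≤ 1) {t : ℝ} (ht : 0 ≤ t) :
    P.real {ω | n * t ≤ |∑ i, (f (Y i ω) - wmean (isingWeight θ) f)|} ≤
      2 * Real.exp (-(n * t ^ 2 / 2)) := by
  have h1 := hY.tail_le hf ht
  have h2 := hY.tail_le (f := fun y => -f y) (fun y => by rw [abs_neg]; exact hf y) ht
  have h3 := measureReal_le_add_of_imp (P := P)
    (p := fun ω => n * t ≤ |∑ i, (f (Y i ω) - wmean (isingWeight θ) f)|)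
    (q := fun ω => n * t ≤ ∑ i, (f (Y i ω) - wmean (isingWeight θ) f))
    (r := fun ω => n * t ≤ ∑ i, (-f (Y i ω) - wmean (isingWeight θ) fun y => -f y))
    fun ω hω => by
      have e : (wmean (isingWeight θ) fun y => -f y) = -wmean (isingWeight θ) f := by
        have := wmean_const_mul (W := isingWeight θ) (-1) f
        simpa using this
      have e2 : ∑ i, (-f (Y i ω) - wmean (isingWeight θ) fun y => -f y) =
          -∑ i, (f (Y i ω) - wmean (isingWeight θ) f) := by
        rw [e, ← Finset.sum_neg_distrib]
        exact Finset.sum_congr rfl fun i _ => by ring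
      rw [e2]
      exact le_abs.1 hω
  linarith

theorem numParam_pos (hd : 2 ≤ d) : 1 ≤ numParam d := by
  have : (2 : ℝ) ≤ d := by exact_mod_cast hd
  rw [numParam]
  nlinarith

/-- The empirical means of the sufficient statistics are uniformly close to their expectations. -/
theorem IsIsingSample.uniform_deviation (hd : 2 ≤ d) (hn : 1 ≤ n) {θ : Param d}
    {Y : Fin n → Ω → Config d} (hY : IsIsingSample P θ Y) {ε : ℝ} (hε : 0 < ε) (hε1 : ε < 1) :
    P.real {ω | ∃ e, n * √(2 * Real.log (2 * numParam d / ε) / n) ≤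
      |∑ i, (J (Y i ω) e - wmean (isingWeight θ) fun y => J y e)|} ≤ ε := by
  have hD := numParam_pos hd
  have hn0 : (0 : ℝ) < n := by exact_mod_cast hn
  have harg : 1 ≤ 2 * numParam d / ε := by
    rw [le_div_iff₀ hε]; linarith
  have hL := Real.log_nonneg harg
  have h := measureReal_exists_le (P := P) (fun (e : Pair d) ω =>
    n * √(2 * Real.log (2 * numParam d / ε) / n) ≤
      |∑ i, (J (Y i ω) e - wmean (isingWeight θ) fun y => J y e)|) fun e =>
    hY.abs_tail_le (f := fun y => J y e) (fun y => (abs_J y e).le) (Real.sqrt_nonneg _)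
  refine h.trans (le_of_eq ?_)
  rw [Real.sq_sqrt (by positivity), card_pair]
  have e1 : (n : ℝ) * (2 * Real.log (2 * numParam d / ε) / n) / 2 =
      Real.log (2 * numParam d / ε) := by field_simp
  rw [e1, Real.exp_neg, Real.exp_log (by linarith)]
  have : numParam d ≠ 0 := by linarith
  field_simp

variable {ψ : Param d} {q : Config d → ℝ} {X : Fin m → Ω → Config d}

theorem sqrt_scale_sq {L B c : ℝ} (hL : 0 ≤ L) (hB : 0 < B) :
    B * (c * √(L / B)) ^ 2 = c ^ 2 * L := by
  rw [mul_pow, Real.sq_sqrt (by positivity)]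
  field_simp

theorem beta2_gibbsKernel_pos (hd : 0 < d) (ψ : Param d) : 0 < beta2 (gibbsKernel ψ) := by
  have h := isReversibleGap_gibbsKernel hd ψ
  exact div_pos (by linarith [h.gap_lt_one]) (by linarith [h.gap_nonneg])

theorem IsMarkovChain.denominator_deviation (hd : 2 ≤ d) (hm : 1 ≤ m)
    (hX : IsMarkovChain P q (gibbsKernel ψ) X) (θ : Param d) {L : ℝ}
    (hlarge : 16 * ratioMax θ (isingDensity ψ) ^ 2 * L ≤ m * beta2 (gibbsKernel ψ)) :
    P.real {ω | (m : ℝ) * (1 / 2) ≤ ∑ k, (1 - densityRatio θ ψ (X k ω))} ≤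
      beta1 q (isingDensity ψ) * Real.exp (-L) := by
  set M := ratioMax θ (isingDensity ψ) with hM
  have hM1 : 1 ≤ M := one_le_ratioMax θ ψ
  have h := hX.tail_le (by omega) (by omega) (f := fun y => 1 - densityRatio θ ψ y)
    -- The lower end 1 - 2M, instead of 1 - M, stays negative when M = 1. The interval has length
    -- 2M, so the exponent is mβ₂/(16M²).
    (a := 1 - 2 * M) (b := 1) (t := 1 / 2) (by linarith) one_pos
    (fun y => ⟨by linarith [densityRatio_le θ ψ y], by linarith [densityRatio_pos θ ψ y]⟩)
    (sum_density_mul_one_sub_ratio θ ψ) (by norm_num)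
  refine h.trans (mul_le_mul_of_nonneg_left (Real.exp_le_exp.2 ?_) (Real.sqrt_nonneg _))
  rw [neg_le_neg_iff, le_div_iff₀ (by nlinarith)]
  linarith

/-- The centred summand lies in [-M(1+μ), M(1-μ)], of length 2M whatever μ is; the threshold is
chosen so that the exponent is exactly L. -/
theorem IsMarkovChain.numerator_deviation (hd : 2 ≤ d) (hm : 1 ≤ m)
    (hX : IsMarkovChain P q (gibbsKernel ψ) X) (θ : Param d) (e : Pair d) {L : ℝ} (hL : 0 < L) :
    P.real {ω | m * (2 * ratioMax θ (isingDensity ψ) * √(L / (m * beta2 (gibbsKernel ψ)))) ≤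
      |∑ k, densityRatio θ ψ (X k ω) * (J (X k ω) e - wmean (isingWeight θ) fun y => J y e)|} ≤
      2 * (beta1 q (isingDensity ψ) * Real.exp (-L)) := by
  set M := ratioMax θ (isingDensity ψ) with hM
  have hM1 : 1 ≤ M := one_le_ratioMax θ ψ
  have hB : 0 < m * beta2 (gibbsKernel ψ) :=
    mul_pos (by exact_mod_cast hm) (beta2_gibbsKernel_pos (by omega) ψ)
  obtain ⟨hμ1, hμ2⟩ := abs_lt.1 (abs_mean_J_lt_one θ e)
  set μ := wmean (isingWeight θ) fun y => J y e with hμ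
  have h := hX.abs_tail_le (by omega) (by omega)
    (f := fun y => densityRatio θ ψ y * (J y e - μ))
    (a := -(M * (1 + μ))) (b := M * (1 - μ)) (t := 2 * M * √(L / (m * beta2 (gibbsKernel ψ))))
    (by nlinarith) (by nlinarith) (fun y => ?_) (sum_density_mul_ratio_mul_centered θ ψ _)
    (by positivity)
  · refine h.trans (le_of_eq ?_)
    rw [sqrt_scale_sq hL.le hB]
    congr 4
    have : M ≠ 0 := by linarith
    rw [show M * (1 - μ) - -(M * (1 + μ)) = 2 * M by ring]
    field_simp
  · obtain ⟨hJ1, hJ2⟩ := abs_le.1 (abs_J y e).le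
    have hw0 := densityRatio_pos θ ψ y
    have hw1 := densityRatio_le θ ψ y
    constructor
    · nlinarith
    · nlinarith

/-- For e = e' the product of statistics is constantly 1, so |μ| = 1 can occur and the sharp range
may have an endpoint at 0. The symmetric range [-2M, 2M] avoids this and doubles the threshold. -/
theorem IsMarkovChain.product_deviation (hd : 2 ≤ d) (hm : 1 ≤ m)
    (hX : IsMarkovChain P q (gibbsKernel ψ) X) (θ : Param d) {f : Config d → ℝ}
    (hf : ∀ y, |f y| ≤ 1) {L : ℝ} (hL : 0 < L) :
    P.real {ω | m * (4 * ratioMax θ (isingDensity ψ) * √(L / (m * beta2 (gibbsKernel ψ)))) ≤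
      |∑ k, densityRatio θ ψ (X k ω) * (f (X k ω) - wmean (isingWeight θ) f)|} ≤
      2 * (beta1 q (isingDensity ψ) * Real.exp (-L)) := by
  set M := ratioMax θ (isingDensity ψ) with hM
  have hM1 : 1 ≤ M := one_le_ratioMax θ ψ
  have hB : 0 < m * beta2 (gibbsKernel ψ) :=
    mul_pos (by exact_mod_cast hm) (beta2_gibbsKernel_pos (by omega) ψ)
  have hμ := abs_wmean_le (fun y => (isingWeight_pos θ y).le) (sum_isingWeight_ne_zero θ) hf
  obtain ⟨hμ1, hμ2⟩ := abs_le.1 hμ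
  set μ := wmean (isingWeight θ) f
  have h := hX.abs_tail_le (by omega) (by omega)
    (f := fun y => densityRatio θ ψ y * (f y - μ))
    (a := -(2 * M)) (b := 2 * M) (t := 4 * M * √(L / (m * beta2 (gibbsKernel ψ))))
    (by linarith) (by linarith) (fun y => ?_) (sum_density_mul_ratio_mul_centered θ ψ _)
    (by positivity)
  · refine h.trans (le_of_eq ?_)
    rw [sqrt_scale_sq hL.le hB]
    congr 4
    have : M ≠ 0 := by linarith
    rw [show 2 * M - -(2 * M) = 4 * M by ring]
    field_simp
  · obtain ⟨hf1, hf2⟩ := abs_le.1 (hf y)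
    have hw0 := densityRatio_pos θ ψ y
    have hw1 := densityRatio_le θ ψ y
    constructor
    · nlinarith
    · nlinarith

end Events

/-! ### From sample deviations to gradient and covariance errors -/

section Oracle

variable {d n m : ℕ}

/-- Holds for every realization; it replaces the deviation bounds when λ is large. -/
theorem abs_mcGrad_le_two [NeZero m] {h : Config d → ℝ} (hh : ∀ y, 0 < h y)
    (Y : Fin n → Config d) (X : Fin m → Config d) (hn : 1 ≤ n) (θ : Param d) (e : Pair d) :
    |mcGrad h Y X θ e| ≤ 2 := by
  have hn0 : (0 : ℝ) < n := by exact_mod_cast hn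
  have h1 : |(1 / (n : ℝ)) * ∑ i, J (Y i) e| ≤ 1 := by
    rw [abs_mul, abs_of_pos (by positivity), one_div, inv_mul_le_iff₀ hn0]
    refine (Finset.abs_sum_le_sum_abs _ _).trans ?_
    simp [abs_J]
  have h2 := abs_wmean_le (fun k => (impWeight_pos hh θ (X k)).le)
    (sum_weight_pos fun k => impWeight_pos hh θ (X k)).ne' fun k => (abs_J (X k) e).le
  rw [mcGrad]
  refine (abs_add_le _ _).trans ?_
  rw [abs_neg]
  linarith

theorem abs_mcGrad_le {ψ : Param d} {Y : Fin n → Config d} {X : Fin m → Config d} (hn : 1 ≤ n)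
    {θ : Param d} {e : Pair d} {s t : ℝ}
    (hY : |∑ i, (J (Y i) e - wmean (isingWeight θ) fun y => J y e)| ≤ n * s)
    (hX : |(wmean (fun k => impWeight (isingDensity ψ) θ (X k)) fun k => J (X k) e) -
      wmean (isingWeight θ) fun y => J y e| ≤ t) :
    |mcGrad (isingDensity ψ) Y X θ e| ≤ s + t := by
  have hn0 : (0 : ℝ) < n := by exact_mod_cast hn
  set μ := wmean (isingWeight θ) fun y => J y e
  have e1 : mcGrad (isingDensity ψ) Y X θ e =
      -((1 / (n : ℝ)) * ∑ i, (J (Y i) e - μ)) +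
        ((wmean (fun k => impWeight (isingDensity ψ) θ (X k)) fun k => J (X k) e) - μ) := by
    rw [mcGrad, Finset.sum_sub_distrib]
    simp only [Finset.sum_const, Finset.card_univ, Fintype.card_fin, nsmul_eq_mul]
    field_simp
    ring
  rw [e1]
  refine (abs_add_le _ _).trans (add_le_add ?_ hX)
  rw [abs_neg, abs_mul, abs_of_pos (by positivity : (0 : ℝ) < 1 / n), one_div,
    inv_mul_le_iff₀ hn0]
  exact hY

/-- The product of means is perturbed one factor at a time, and means of ±1 variables are bounded by
1. -/
theorem abs_wcov_sub_le [NeZero m] {ψ θ : Param d} {X : Fin m → Config d} {s t : ℝ}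
    (hs : ∀ e, |(wmean (fun k => impWeight (isingDensity ψ) θ (X k)) fun k => J (X k) e) -
      wmean (isingWeight θ) fun y => J y e| ≤ s) (e e' : Pair d)
    (ht : |(wmean (fun k => impWeight (isingDensity ψ) θ (X k)) fun k => J (X k) e * J (X k) e') -
      wmean (isingWeight θ) fun y => J y e * J y e'| ≤ t) :
    |wcov (fun k => impWeight (isingDensity ψ) θ (X k)) (fun k => J (X k)) e e' -
      wcov (isingWeight θ) J e e'| ≤ t + 2 * s := by
  have hh := isingDensity_pos ψ
  have h1 := abs_wmean_le (fun k => (impWeight_pos hh θ (X k)).le)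
    (sum_weight_pos fun k => impWeight_pos hh θ (X k)).ne' fun k => (abs_J (X k) e').le
  have h2 := (abs_mean_J_lt_one θ e).le
  have h3 := hs e
  have h4 := hs e'
  simp only [wcov]
  generalize (wmean (fun k => impWeight (isingDensity ψ) θ (X k)) fun k => J (X k) e') = A' at *
  generalize (wmean (fun k => impWeight (isingDensity ψ) θ (X k)) fun k => J (X k) e) = A at *
  generalize (wmean (isingWeight θ) fun y => J y e') = μ' at *
  generalize (wmean (isingWeight θ) fun y => J y e) = μ at *
  generalize (wmean (fun k => impWeight (isingDensity ψ) θ (X k))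
    fun k => J (X k) e * J (X k) e') = B at *
  generalize (wmean (isingWeight θ) fun y => J y e * J y e') = ν at *
  have e1 : B - A * A' - (ν - μ * μ') = (B - ν) + (-((A - μ) * A') + -(μ * (A' - μ'))) := by ring
  rw [e1]
  refine (abs_add_le _ _).trans (add_le_add ht ((abs_add_le _ _).trans ?_))
  rw [abs_neg, abs_neg, abs_mul, abs_mul]
  have h5 : |A - μ| * |A'| ≤ s * 1 :=
    mul_le_mul h3 h1 (abs_nonneg _) ((abs_nonneg _).trans h3)
  have h6 : |μ| * |A' - μ'| ≤ 1 * s := mul_le_mul h2 h4 (abs_nonneg _) zero_le_one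
  linarith

theorem sqrt_log_div_le {N Q F L c : ℝ} (hN : 0 < N) (hQ : 0 < Q) (hF : 0 < F) (hc : 0 < c)
    (h : c ^ 2 * Q ^ 2 * L / F ^ 2 ≤ N) : √(L / N) ≤ F / (c * Q) := by
  refine Real.sqrt_le_iff.2 ⟨by positivity, ?_⟩
  rw [div_le_iff₀ (by positivity)] at h
  rw [div_pow, div_le_div_iff₀ hN (by positivity)]
  nlinarith

end Oracle

/-! ### The event where both samples are well behaved -/

section GoodEvent

variable {Ω : Type*} [MeasurableSpace Ω] {P : Measure Ω} [IsProbabilityMeasure P] {d n m : ℕ}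

theorem one_le_measureReal_add {C p₁ p₂ p₃ p₄ : Ω → Prop}
    (h : ∀ ω, ¬ p₁ ω → ¬ p₂ ω → ¬ p₃ ω → ¬ p₄ ω → C ω) :
    1 ≤ P.real {ω | C ω} + (P.real {ω | p₁ ω} + (P.real {ω | p₂ ω} +
      (P.real {ω | p₃ ω} + P.real {ω | p₄ ω}))) := by
  have h1 := measureReal_le_add_of_imp (P := P) (p := fun _ => True) (q := C)
    (r := fun ω => p₁ ω ∨ p₂ ω ∨ p₃ ω ∨ p₄ ω) fun ω _ => by
      have := h ω
      tauto
  have h2 := measureReal_le_add_of_imp (P := P) (p := fun ω => p₁ ω ∨ p₂ ω ∨ p₃ ω ∨ p₄ ω)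
    (q := p₁) (r := fun ω => p₂ ω ∨ p₃ ω ∨ p₄ ω) fun ω h => h
  have h3 := measureReal_le_add_of_imp (P := P) (p := fun ω => p₂ ω ∨ p₃ ω ∨ p₄ ω)
    (q := p₂) (r := fun ω => p₃ ω ∨ p₄ ω) fun ω h => h
  have h4 := measureReal_le_add_of_imp (P := P) (p := fun ω => p₃ ω ∨ p₄ ω)
    (q := p₃) (r := p₄) fun ω h => h
  rw [Set.ofPred_true, probReal_univ] at h1
  linarith

/-- With probability at least `1 - 3 ε`, the gradient at the true parameter is small and the
observed information is close to the Fisher information. -/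
theorem IsMarkovChain.one_sub_le_good_event (hd : 2 ≤ d) (hn : 1 ≤ n) (hm : 1 ≤ m)
    [NeZero m] {θ ψ : Param d} {q : Config d → ℝ} {X : Fin m → Ω → Config d}
    {Y : Fin n → Ω → Config d} (hX : IsMarkovChain P q (gibbsKernel ψ) X)
    (hY : IsIsingSample P θ Y) {ε L₁ L₂ : ℝ} (hε : 0 < ε) (hε1 : ε < 1) (hL₁0 : 0 < L₁)
    (hL₁₂ : L₁ ≤ L₂)
    (hE₁ : beta1 q (isingDensity ψ) * Real.exp (-L₁) = ε / (2 * numParam d + 1))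
    (hE₂ : beta1 q (isingDensity ψ) * Real.exp (-L₂) =
      ε / (2 * numParam d * (numParam d + 1)))
    (hlarge : 16 * ratioMax θ (isingDensity ψ) ^ 2 * L₁ ≤ m * beta2 (gibbsKernel ψ))
    {C : Ω → Prop}
    (hC : ∀ ω,
      (∀ e, |mcGrad (isingDensity ψ) (fun i => Y i ω) (fun k => X k ω) θ e| ≤
        √(2 * Real.log (2 * numParam d / ε) / n) + 2 * (2 * ratioMax θ (isingDensity ψ) *
          √(L₁ / (m * beta2 (gibbsKernel ψ))))) →
      (∀ e e', |wcov (fun k => impWeight (isingDensity ψ) θ (X k ω)) (fun k => J (X k ω)) e e' -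
          wcov (isingWeight θ) J e e'| ≤
        2 * (4 * ratioMax θ (isingDensity ψ) * √(L₂ / (m * beta2 (gibbsKernel ψ)))) +
          2 * (2 * (2 * ratioMax θ (isingDensity ψ) *
            √(L₁ / (m * beta2 (gibbsKernel ψ)))))) → C ω) :
    1 - 3 * ε ≤ P.real {ω | C ω} := by
  have hD := numParam_pos hd
  have p1 := hY.uniform_deviation hd hn hε hε1
  have p2 := hX.denominator_deviation hd hm θ hlarge
  have p3 := measureReal_exists_le (P := P) _ fun e => hX.numerator_deviation hd hm θ e hL₁0
  have p4 := measureReal_exists_le (P := P) _ fun e : Pair d × Pair d =>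
    hX.product_deviation hd hm θ (f := fun y => J y e.1 * J y e.2)
      (fun y => by rw [abs_mul, abs_J, abs_J, one_mul]) (hL₁0.trans_le hL₁₂)
  rw [hE₁] at p2 p3
  rw [hE₂, Fintype.card_prod] at p4
  push_cast at p4
  rw [card_pair] at p3 p4
  -- One denominator event and two tails for each coordinate: 2d̄ + 1 events, which is the count in
  -- the logarithm of λ. The d̄² products with two tails use the count 2d̄(d̄+1) in the same way.
  have p23 : ε / (2 * numParam d + 1) + numParam d * (2 * (ε / (2 * numParam d + 1))) = ε := by
    field_simp
    ring
  have p4' : numParam d * numParam d * (2 * (ε / (2 * numParam d * (numParam d + 1)))) ≤ ε := by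
    have e : numParam d * numParam d * (2 * (ε / (2 * numParam d * (numParam d + 1)))) =
        ε * (numParam d / (numParam d + 1)) := by
      have : numParam d ≠ 0 := by linarith
      field_simp
    rw [e]
    have : numParam d / (numParam d + 1) ≤ 1 := by
      rw [div_le_one (by linarith)]
      linarith
    nlinarith
  have hcover := one_le_measureReal_add (P := P) (C := C)
    (p₁ := fun ω => ∃ e, n * √(2 * Real.log (2 * numParam d / ε) / n) ≤
      |∑ i, (J (Y i ω) e - wmean (isingWeight θ) fun y => J y e)|)
    (p₂ := fun ω => (m : ℝ) * (1 / 2) ≤ ∑ k, (1 - densityRatio θ ψ (X k ω)))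
    (p₃ := fun ω => ∃ e, m * (2 * ratioMax θ (isingDensity ψ) *
      √(L₁ / (m * beta2 (gibbsKernel ψ)))) ≤ |∑ k, densityRatio θ ψ (X k ω) *
        (J (X k ω) e - wmean (isingWeight θ) fun y => J y e)|)
    (p₄ := fun ω => ∃ e : Pair d × Pair d, m * (4 * ratioMax θ (isingDensity ψ) *
      √(L₂ / (m * beta2 (gibbsKernel ψ)))) ≤ |∑ k, densityRatio θ ψ (X k ω) *
        (J (X k ω) e.1 * J (X k ω) e.2 - wmean (isingWeight θ) fun y => J y e.1 * J y e.2)|)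
    fun ω g1 g2 g3 g4 => by
      simp only [not_exists, not_le] at g1 g2 g3 g4
      have hden : (m : ℝ) * (1 / 2) ≤ ∑ k, densityRatio θ ψ (X k ω) := by
        rw [Finset.sum_sub_distrib] at g2
        simp only [Finset.sum_const, Finset.card_univ, Fintype.card_fin, nsmul_eq_mul,
          mul_one] at g2
        linarith
      have hmean := fun e => abs_wmean_impWeight_sub_le θ ψ (f := fun y => J y e) hden (g3 e).le
      exact hC ω (fun e => abs_mcGrad_le hn (g1 e).le (hmean e)) fun e e' =>
        abs_wcov_sub_le hmean e e' (abs_wmean_impWeight_sub_le θ ψ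
          (f := fun y => J y e * J y e') hden (g4 (e, e')).le)
  linarith

end GoodEvent

/-! ### Choice of the smoothing parameter -/

section Smoothing

variable {d n m : ℕ}

theorem two_lt_alpha {ξ : ℝ} (hξ : 1 < ξ) : 2 < alpha ξ := by
  have : 0 < Real.exp 1 / (ξ - 1) := div_pos (Real.exp_pos _) (by linarith)
  rw [alpha]
  linarith

/-- Explains α: the choice α - 2 = e/(ξ-1) turns the smallness condition of the oracle inequality
into the bound on v. -/
theorem smoothing_arith {ξ F d₀ v : ℝ} (hξ : 1 < ξ) (hd₀ : 0 < d₀)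
    (hv : v ≤ F / ((1 + ξ) ^ 2 * alpha ξ * d₀)) :
    (ξ + 1) / (ξ - 1) * v * (ξ + 1) * d₀ ≤ F * (alpha ξ - 2) / alpha ξ * Real.exp (-1) := by
  have hξ1 : 0 < ξ - 1 := by linarith
  have h4 : alpha ξ ≠ 0 := by linarith [two_lt_alpha hξ]
  calc (ξ + 1) / (ξ - 1) * v * (ξ + 1) * d₀
      ≤ (ξ + 1) / (ξ - 1) * (F / ((1 + ξ) ^ 2 * alpha ξ * d₀)) * (ξ + 1) * d₀ := by
        gcongr
    _ = F * (Real.exp 1 / (ξ - 1)) / alpha ξ * Real.exp (-1) := by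
        have h5 : 1 + ξ ≠ 0 := by linarith
        rw [Real.exp_neg]
        field_simp
        ring
    _ = F * (alpha ξ - 2) / alpha ξ * Real.exp (-1) := by
        rw [show alpha ξ - 2 = Real.exp 1 / (ξ - 1) by rw [alpha]; ring]

theorem exists_isLassoMinimizer_and_norm_sub_le [NeZero m] {h : Config d → ℝ}
    (Y : Fin n → Config d) (X : Fin m → Config d) (hh : ∀ y, 0 < h y) {θs : Param d}
    {ξ lam δ F v : ℝ} (hξ : 1 < ξ) (hv : 0 < v) (hlam : lam = (ξ + 1) / (ξ - 1) * v)
    (hF : F = coneInvFactor ξ (supp θs) (hessian (fun θ => Real.log (normConst θ)) θs))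
    (hgrad : ∀ e, |mcGrad h Y X θs e| ≤ v)
    (hcov : (supp θs).Nonempty → ∀ e e',
      |wcov (fun k => impWeight h θs (X k)) (fun k => J (X k)) e e' -
        wcov (isingWeight θs) J e e'| ≤ δ)
    (hsmall : (supp θs).Nonempty → v ≤ F / ((1 + ξ) ^ 2 * alpha ξ * (supp θs).card))
    (hδ : (supp θs).Nonempty → δ ≤ 2 * (F / ((1 + ξ) ^ 2 * alpha ξ * (supp θs).card))) :
    (∃ θ, IsLassoMinimizer h Y X lam θ) ∧ ∀ θ, IsLassoMinimizer h Y X lam θ →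
      ‖θ - θs‖ ≤ 2 * Real.exp 1 * ξ * alpha ξ * lam / ((ξ + 1) * (alpha ξ - 2) * F) := by
  have hξ1 : 0 < ξ - 1 := by linarith
  have hα : 0 < alpha ξ := by linarith [two_lt_alpha hξ]
  have hvlam : (ξ - 1) / (ξ + 1) * lam = v := by
    rw [hlam]
    field_simp
  have hlt : v < lam := by
    rw [hlam]
    refine lt_mul_of_one_lt_left hv ?_
    rw [one_lt_div hξ1]
    linarith
  refine ⟨exists_isLassoMinimizer Y X hh hlt hgrad, fun θ hθ =>
    hθ.norm_sub_le Y X hh hξ (hv.trans hlt) hF (hvlam.symm ▸ hgrad) hcov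
      (fun hT => ?_) fun hT => ?_⟩
  · have hd0 : (0 : ℝ) < (supp θs).card := by exact_mod_cast Finset.card_pos.2 hT
    have h3 := mul_le_mul_of_nonneg_right (hδ hT)
      (by positivity : 0 ≤ (1 + ξ) ^ 2 * ((supp θs).card : ℝ))
    refine le_trans (le_of_eq (by ring)) (h3.trans (le_of_eq ?_))
    have : 1 + ξ ≠ 0 := by linarith
    field_simp
  · rw [hlam]
    exact smoothing_arith hξ (by exact_mod_cast Finset.card_pos.2 hT) (hsmall hT)

end Smoothing

end IsingMCMC

end

/-! ### Assembly of the oracle inequality and the deviation bounds -/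

open IsingMCMC
theorem theorem1 {Ω : Type*} [MeasurableSpace Ω] (P : Measure Ω) [IsProbabilityMeasure P]
    (d n m : ℕ) (hd : 2 ≤ d) (hn : 1 ≤ n) (hm : 1 ≤ m)
    (θs ψ : Param d) (q : Config d → ℝ)
    (Y : Fin n → Ω → Config d) (X : Fin m → Ω → Config d)
    (hY : IsIsingSample P θs Y) (hX : IsMarkovChain P q (gibbsKernel ψ) X)
    (ε ξ : ℝ) (hε : 0 < ε) (hξ : 1 < ξ)
    (d₀ F M b1 b2 lam : ℝ)
    (hd₀ : d₀ = (supp θs).card)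
    (hF : F = coneInvFactor ξ (supp θs) (hessian (fun θ => Real.log (normConst θ)) θs))
    (hM : M = ratioMax θs (isingDensity ψ))
    (hb1 : b1 = beta1 q (isingDensity ψ))
    (hb2 : b2 = beta2 (gibbsKernel ψ))
    (hlam : lam = lassoLam ε ξ n m d M b1 b2)
    (hncond : (n : ℝ) ≥
      8 * (1 + ξ) ^ 4 * alpha ξ ^ 2 * d₀ ^ 2 * Real.log (2 * numParam d / ε) / F ^ 2)
    (hmcond : (m : ℝ) ≥
      64 * (1 + ξ) ^ 4 * alpha ξ ^ 2 * d₀ ^ 2 * M ^ 2 *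
        Real.log (2 * numParam d * (numParam d + 1) * b1 / ε) / (F ^ 2 * b2)) :
    1 - 4 * ε ≤ P.real {ω |
      (∃ θ, IsLassoMinimizer (isingDensity ψ) (fun i => Y i ω) (fun k => X k ω) lam θ) ∧
      ∀ θ, IsLassoMinimizer (isingDensity ψ) (fun i => Y i ω) (fun k => X k ω) lam θ →
        ‖θ - θs‖ ≤ 2 * Real.exp 1 * ξ * alpha ξ * lam / ((ξ + 1) * (alpha ξ - 2) * F)} := by

  rcases le_or_gt (1 / 4) ε with hε4 | hε4
  · exact le_trans (by linarith) measureReal_nonneg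
  have : NeZero m := ⟨by omega⟩
  have hh := isingDensity_pos ψ
  have hm0 : (0 : ℝ) < m := by exact_mod_cast hm
  have hn0 : (0 : ℝ) < n := by exact_mod_cast hn
  have hD : 1 ≤ numParam d := numParam_pos hd
  have hM1 : 1 ≤ M := hM ▸ one_le_ratioMax θs ψ
  have hb2pos : 0 < b2 := hb2 ▸ beta2_gibbsKernel_pos (by omega) ψ
  have hb1ge : 1 ≤ b1 := hb1 ▸ one_le_beta1 hh (sum_isingDensity ψ) (hX.one_le_sum (by omega))
  have hN : 0 < m * b2 := mul_pos hm0 hb2pos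
  have hξ1 : 0 < ξ - 1 := by linarith
  have hα := two_lt_alpha hξ
  set A₁ := (2 * numParam d + 1) * b1 / ε with hA₁
  set A₂ := 2 * numParam d * (numParam d + 1) * b1 / ε with hA₂
  have hA₁1 : 1 < A₁ := by
    rw [hA₁, lt_div_iff₀ hε]
    have := le_mul_of_one_le_left (by linarith : 0 ≤ b1) (by linarith : 1 ≤ 2 * numParam d + 1)
    linarith
  have hA₁₂ : A₁ ≤ A₂ := by
    rw [hA₁, hA₂]
    refine div_le_div_of_nonneg_right ?_ hε.le
    refine mul_le_mul_of_nonneg_right ?_ (by linarith)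
    have := mul_le_mul_of_nonneg_left hD (by linarith : 0 ≤ numParam d)
    linarith
  set L₁ := Real.log A₁ with hL₁
  set L₂ := Real.log A₂ with hL₂
  have hL₁0 : 0 < L₁ := Real.log_pos hA₁1
  have hL₁₂ : L₁ ≤ L₂ := Real.log_le_log (by linarith) hA₁₂
  have hE₁ : b1 * Real.exp (-L₁) = ε / (2 * numParam d + 1) := by
    rw [Real.exp_neg, hL₁, Real.exp_log (by linarith), hA₁]
    field_simp
  have hE₂ : b1 * Real.exp (-L₂) = ε / (2 * numParam d * (numParam d + 1)) := by
    rw [Real.exp_neg, hL₂, Real.exp_log (by linarith), hA₂]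
    field_simp
  set s := √(2 * Real.log (2 * numParam d / ε) / n) with hs
  set x₁ := √(L₁ / (m * b2)) with hx₁
  set x₂ := √(L₂ / (m * b2)) with hx₂
  have hx₁₂ : x₁ ≤ x₂ := Real.sqrt_le_sqrt (div_le_div_of_nonneg_right hL₁₂ hN.le)
  have hs0 : 0 < s := by
    have : 0 < Real.log (2 * numParam d / ε) := by
      refine Real.log_pos ?_
      rw [lt_div_iff₀ hε]
      linarith
    positivity
  have hlam' : lam = (ξ + 1) / (ξ - 1) * max (2 * s) (8 * M * x₁) := hlam
  -- The sample size conditions solved for the deviations: 8 = 2·2² and 64 = 8² are the squared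
  -- prefactors of the two roots in λ.
  have hsupp : (supp θs).Nonempty → 0 < F ∧ 2 * s ≤ F / ((1 + ξ) ^ 2 * alpha ξ * d₀) ∧
      8 * M * x₂ ≤ F / ((1 + ξ) ^ 2 * alpha ξ * d₀) ∧ 0 < (1 + ξ) ^ 2 * alpha ξ * d₀ := by
    intro hT
    have hF0 : 0 < F := hF ▸ coneInvFactor_pos (by linarith) hT θs
    have hd0 : 0 < d₀ := by
      rw [hd₀]
      exact_mod_cast Finset.card_pos.2 hT
    have hQ : 0 < (1 + ξ) ^ 2 * alpha ξ * d₀ := by positivity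
    refine ⟨hF0, ?_, ?_, hQ⟩
    · have h1 := sqrt_log_div_le (L := 2 * Real.log (2 * numParam d / ε)) hn0 hQ hF0 two_pos
        (le_trans (le_of_eq (by ring)) hncond)
      have h2 := mul_le_mul_of_nonneg_left h1 zero_le_two
      refine h2.trans (le_of_eq ?_)
      field_simp
    · have h1 := sqrt_log_div_le (L := L₂) (c := 8 * M) hN hQ hF0 (by linarith) (by
        have h3 := mul_le_mul_of_nonneg_right hmcond hb2pos.le
        refine le_trans (le_of_eq ?_) h3
        field_simp
        ring)
      have h2 := mul_le_mul_of_nonneg_left h1 (by linarith : 0 ≤ 8 * M)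
      refine h2.trans (le_of_eq ?_)
      have : M ≠ 0 := by linarith
      field_simp
  have hdet : ∀ ω,
      (∀ e, |mcGrad (isingDensity ψ) (fun i => Y i ω) (fun k => X k ω) θs e| ≤
        max (2 * s) (8 * M * x₁)) →
      ((supp θs).Nonempty → ∀ e e',
        |wcov (fun k => impWeight (isingDensity ψ) θs (X k ω)) (fun k => J (X k ω)) e e' -
          wcov (isingWeight θs) J e e'| ≤ 16 * M * x₂) →
      (∃ θ, IsLassoMinimizer (isingDensity ψ) (fun i => Y i ω) (fun k => X k ω) lam θ) ∧
      ∀ θ, IsLassoMinimizer (isingDensity ψ) (fun i => Y i ω) (fun k => X k ω) lam θ →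
        ‖θ - θs‖ ≤ 2 * Real.exp 1 * ξ * alpha ξ * lam / ((ξ + 1) * (alpha ξ - 2) * F) := by
    intro ω hgrad hcov
    refine exists_isLassoMinimizer_and_norm_sub_le _ _ hh hξ (lt_max_of_lt_left (by linarith))
      hlam' hF hgrad hcov (fun hT => ?_) fun hT => ?_
    · obtain ⟨-, h1, h2, -⟩ := hsupp hT
      rw [← hd₀]
      exact max_le h1 (le_trans (mul_le_mul_of_nonneg_left hx₁₂ (by linarith)) h2)
    · obtain ⟨-, -, h2, -⟩ := hsupp hT
      rw [← hd₀]
      linarith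
  -- The threshold is the one at which the denominator deviation bound with exponent L₁ becomes
  -- available.
  rcases le_or_gt (m * b2) (16 * M ^ 2 * L₁) with hsmall | hlarge
  · have hx : 1 / (4 * M) ≤ x₁ := by
      refine Real.le_sqrt_of_sq_le ?_
      rw [div_pow, div_le_div_iff₀ (by positivity) hN]
      linarith
    have hx' : 1 ≤ 4 * M * x₁ := by
      rw [div_le_iff₀ (by positivity)] at hx
      linarith
    have hall : ∀ ω,
        (∃ θ, IsLassoMinimizer (isingDensity ψ) (fun i => Y i ω) (fun k => X k ω) lam θ) ∧
        ∀ θ, IsLassoMinimizer (isingDensity ψ) (fun i => Y i ω) (fun k => X k ω) lam θ →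
          ‖θ - θs‖ ≤ 2 * Real.exp 1 * ξ * alpha ξ * lam / ((ξ + 1) * (alpha ξ - 2) * F) := by
      intro ω
      refine hdet ω (fun e => (abs_mcGrad_le_two hh _ _ hn θs e).trans
        (le_trans (by linarith) (le_max_right _ _))) fun hT => ?_
      -- For nonempty T the condition on m gives 8Mx₂ ≤ F/((1+ξ)²αd₀) ≤ 1, against 8Mx₂ ≥ 8Mx₁ ≥ 2.
      exfalso
      obtain ⟨hF0, -, h2, hQ⟩ := hsupp hT
      have hF1 : F ≤ 1 := hF ▸ coneInvFactor_le_one (by linarith) hT θs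
      have hd1 : 1 ≤ d₀ := by
        rw [hd₀]
        exact_mod_cast Finset.card_pos.2 hT
      have hQ1 : 1 ≤ (1 + ξ) ^ 2 * alpha ξ * d₀ :=
        one_le_mul_of_one_le_of_one_le
          (one_le_mul_of_one_le_of_one_le (one_le_pow₀ (by linarith)) (by linarith)) hd1
      have h3 : F / ((1 + ξ) ^ 2 * alpha ξ * d₀) ≤ 1 := by
        rw [div_le_one hQ]
        linarith
      have h4 := mul_le_mul_of_nonneg_left hx₁₂ (by linarith : 0 ≤ 8 * M)
      linarith
    calc 1 - 4 * ε ≤ P.real Set.univ := by rw [probReal_univ]; linarith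
      _ ≤ _ := measureReal_mono fun ω _ => hall ω
  · subst hM hb1 hb2
    have h3ε := hX.one_sub_le_good_event hd hn hm hY hε (by linarith) hL₁0 hL₁₂ hE₁ hE₂ hlarge.le
      fun ω hgrad hcov => hdet ω (fun e => (hgrad e).trans ?_)
        fun _ e e' => (hcov e e').trans ?_
    · linarith
    -- The gradient error s + 4Mx₁ is the average of 2s and 8Mx₁, hence at most their maximum.
    · have h1 := le_max_left (2 * s) (8 * ratioMax θs (isingDensity ψ) * x₁)
      have h2 := le_max_right (2 * s) (8 * ratioMax θs (isingDensity ψ) * x₁)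
      linarith
    · have := mul_le_mul_of_nonneg_left hx₁₂
        (by linarith : 0 ≤ 8 * ratioMax θs (isingDensity ψ))
      linarith
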